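/- Let $S$ be a smooth complex affine surface (a variety) which is contractible in its analytic topology. Let $\Delta\subset S\times S$ be the diagonal with ideal sheaf $\mathcal I_\Delta$, let $T=(S\times S)\setminus\Delta$, and let $\pi:T\to S$ be the restriction of the first projection. Let $$0\to\mathcal O_{S\times S}\to\mathcal F\xrightarrow{\,b\,}\mathcal I_\Delta\to 0$$ be any exact sequence with $\mathcal F$ locally free of rank $2$ (such a resolution is provided by the Serre construction). Let $H\subset\mathbb P(\mathcal F)=\mathrm{Proj}(\mathrm{Sym}^{\cdot}\mathcal F)$ be the closed subscheme $\mathrm{Proj}(\mathrm{Sym}^{\cdot}\mathcal I_\Delta)$ determined by $b$, and put $\mathcal V_\Delta=\mathbb P(\mathcal F)\setminus H$. Then the structure morphism $\mathcal V_\Delta\to S\times S$ factors through a morphism $\rho_\Delta:\mathcal V_\Delta\to T$, and with $h=\pi\circ\rho_\Delta$ the following hold. a) $\mathcal V_\Delta$ is a smooth affine variety (integral scheme) of dimension $5$ over $\mathbb C$. b) The morphism $h:\mathcal V_\Delta\to S$ is smooth and surjective. c) Let $j:\{p\}\hookrightarrow S$ be a closed point with ideal sheaf $\mathcal I_p$.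 Then $\mathcal I_p$ has a resolution $0\to\mathcal O_S\to\mathcal E\to\mathcal I_p\to0$ with $\mathcal E$ locally free of rank $2$. Let $\rho_p:V_p(S)\to S\setminus\{p\}$ be either the scheme $\mathbb P(\mathcal E)\setminus\mathrm{Proj}(\mathrm{Sym}^{\cdot}\mathcal I_p)$ for any such resolution, or, for any two generators $f,g\in\Gamma(S,\mathcal O_S)$ of the ideal of $p$, the hypersurface $\{fV-gU=1\}\subset S\times\mathbb A^2$ (with coordinates $U,V$ on $\mathbb A^2$), with its projection to $S$. This projection has image in $S\setminus\{p\}$, the map $s\mapsto(p,s)$ restricts to a morphism $S\setminus\{p\}\to T$, and there is a commutative diagram with cartesian squares $$\begin{array}{ccc}V_p(S)&\longrightarrow&\mathcal V_\Delta\\ {\scriptstyle\rho_p}\downarrow& &\downarrow{\scriptstyle\rho_\Delta}\\ S\setminus\{p\}&\longrightarrow&T\\ \downarrow& &\downarrow{\scriptstyle\pi}\\ \{p\}&\stackrel{j}{\longrightarrow}&S.\end{array}$$ In particular the scheme-theoretic fiber of $h$ over $p$ is $V_p(S)$. -/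

import Mathlib

open CategoryTheory AlgebraicGeometry
open scoped TensorProduct DirectSum

namespace SerreTorsor

/-! ### The symmetric algebra as a graded algebra -/

section Grading

variable (R : Type) [CommRing R] (M : Type) [AddCommGroup M] [Module R M]

/-- The degree `n` part `Symⁿ M` of the symmetric algebra of `M`. -/
def symGrading (n : ℕ) : Submodule R (SymmetricAlgebra R M) :=
  LinearMap.range (SymmetricAlgebra.ι R M) ^ n

instance symGrading_gradedMonoid : SetLike.GradedMonoid (symGrading R M) :=
  inferInstanceAs (SetLike.GradedMonoid
    fun n : ℕ => LinearMap.range (SymmetricAlgebra.ι R M) ^ n)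

theorem ι_mem_symGrading (m : M) : SymmetricAlgebra.ι R M m ∈ symGrading R M 1 := by
  simpa only [symGrading, pow_one] using LinearMap.mem_range_self _ m

/-- The inclusion of `M` in degree one of `⨁ Symⁿ M`. -/
noncomputable def gradedι : M →ₗ[R] ⨁ n : ℕ, symGrading R M n :=
  DirectSum.lof R ℕ (fun n => symGrading R M n) 1 ∘ₗ
    (SymmetricAlgebra.ι R M).codRestrict _ (ι_mem_symGrading R M)

theorem gradedι_apply (m : M) :
    gradedι R M m = DirectSum.of (fun n : ℕ => symGrading R M n) 1
      ⟨SymmetricAlgebra.ι R M m, ι_mem_symGrading R M m⟩ :=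
  rfl

/-- `Sym M = ⨁ Symⁿ M` is an `ℕ`-graded `R`-algebra. -/
noncomputable instance symGradedAlgebra : GradedAlgebra (symGrading R M) :=
  GradedAlgebra.ofAlgHom _ (SymmetricAlgebra.lift (gradedι R M))
    (by
      apply SymmetricAlgebra.algHom_ext
      ext m
      change DirectSum.coeAlgHom (symGrading R M)
        (SymmetricAlgebra.lift (gradedι R M) (SymmetricAlgebra.ι R M m)) =
          SymmetricAlgebra.ι R M m
      rw [SymmetricAlgebra.lift_ι_apply, gradedι_apply, DirectSum.coeAlgHom_of])
    fun i x => by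
    obtain ⟨x, hx⟩ := x
    dsimp only [Subtype.coe_mk, DirectSum.lof_eq_of]
    induction hx using Submodule.pow_induction_on_left' with
    | algebraMap r =>
      rw [AlgHom.commutes, DirectSum.algebraMap_apply]; rfl
    | add x y i hx hy ihx ihy =>
      rw [map_add, ihx, ihy, ← map_add]
      rfl
    | mem_mul m hm i x hx ih =>
      obtain ⟨_, rfl⟩ := hm
      rw [map_mul, ih, SymmetricAlgebra.lift_ι_apply, gradedι_apply, DirectSum.of_mul_of]
      exact DirectSum.of_eq_of_gradedMonoid_eq (Sigma.subtype_ext (add_comm _ _) rfl)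

/-- The projective bundle `P(F) = Proj (Sym M)` over `Spec R` of the sheaf `F` of the module `M`. -/
noncomputable def projBundle : Scheme.{0} := Proj (symGrading R M)

/-- The structure morphism `P(F) ⟶ Spec R`. -/
noncomputable def projBundleHom : projBundle R M ⟶ Spec (.of R) :=
  Proj.toSpecZero (symGrading R M) ≫
    Spec.map (CommRingCat.ofHom (algebraMap R (symGrading R M 0)))

end Grading

/-! ### Locally free resolutions of ideals and the associated bundles -/

/-- A resolution `0 ⟶ O_Y ⟶ F ⟶ I ⟶ 0` of the ideal sheaf `I` on the affine scheme `Y = Spec R`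
with `F` locally free of rank `2`, in terms of modules of global sections. -/
structure Resolution {R : Type} [CommRing R] (I : Ideal R) where
  /-- the module of global sections of `F` -/
  F : Type
  [addCommGroup : AddCommGroup F]
  [module : Module R F]
  [finite : Module.Finite R F]
  [projective : Module.Projective R F]
  rank_eq : ∀ y : PrimeSpectrum R, Module.rankAtStalk F y = 2
  /-- the map `O_Y ⟶ F` -/
  a : R →ₗ[R] F
  /-- the map `F ⟶ I` -/
  b : F →ₗ[R] I
  a_injective : Function.Injective a
  exact : Function.Exact a b
  b_surjective : Function.Surjective b

attribute [instance] Resolution.addCommGroup Resolution.module Resolution.finite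
  Resolution.projective

namespace Resolution

variable {R : Type} [CommRing R] {I : Ideal R} (E : Resolution I)

/-- The surjection `Sym F ⟶ Sym I` induced by `b`. -/
noncomputable def symMap : SymmetricAlgebra R E.F →ₐ[R] SymmetricAlgebra R I :=
  SymmetricAlgebra.lift (SymmetricAlgebra.ι R I ∘ₗ E.b)

/-- The complement in `P(F)` of the closed subscheme `H = Proj (Sym I)` cut out by the kernel of
`Sym F ⟶ Sym I`. -/
noncomputable def complH : (projBundle R E.F).Opens :=
  ⟨(ProjectiveSpectrum.zeroLocus (symGrading R E.F) (RingHom.ker E.symMap))ᶜ,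
    (ProjectiveSpectrum.isClosed_zeroLocus (symGrading R E.F) _).isOpen_compl⟩

/-- The scheme `V = P(F) ∖ H`. -/
noncomputable def V : Scheme.{0} := E.complH.toScheme

/-- The restriction `V ⟶ Y = Spec R` of the structure morphism of `P(F)`. -/
noncomputable def toBase : E.V ⟶ Spec (.of R) := E.complH.ι ≫ projBundleHom R E.F

end Resolution

/-- The open complement in `Spec R` of the closed subscheme defined by `I`. -/
def compl {R : Type} [CommRing R] (I : Ideal R) : (Spec (.of R)).Opens :=
  ⟨(PrimeSpectrum.zeroLocus (I : Set R))ᶜ, (PrimeSpectrum.isClosed_zeroLocus _).isOpen_compl⟩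

/-! ### Complex affine varieties -/

/-- The closed points of the complex variety `Spec A`. -/
def ComplexPoints (A : Type) [CommRing A] [Algebra ℂ A] : Type := A →ₐ[ℂ] ℂ

/-- The analytic topology: the coarsest one for which all regular functions are continuous. For
`A` generated by `a₁, …, aₙ` it is the subspace topology from `ℂⁿ`. -/
noncomputable instance (A : Type) [CommRing A] [Algebra ℂ A] :
    TopologicalSpace (ComplexPoints A) :=
  TopologicalSpace.induced (fun (x : A →ₐ[ℂ] ℂ) (a : A) => x a) inferInstance

section Family

variable (A : Type) [CommRing A] [Algebra ℂ A]

/-- The structure morphism `Spec A ⟶ Spec ℂ`. -/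
noncomputable def structureHom : Spec (.of A) ⟶ Spec (.of ℂ) :=
  Spec.map (CommRingCat.ofHom (algebraMap ℂ A))

/-- The ideal of the diagonal `Δ` of `S × S`, where `S = Spec A` and `S × S = Spec (A ⊗ A)`. -/
noncomputable abbrev diagonalIdeal : Ideal (A ⊗[ℂ] A) := KaehlerDifferential.ideal ℂ A

/-- The scheme `T = S × S ∖ Δ`. -/
noncomputable abbrev T : Scheme.{0} := (compl (diagonalIdeal A)).toScheme

/-- The open immersion `T ⟶ S × S`. -/
noncomputable abbrev inclT : T A ⟶ Spec (.of (A ⊗[ℂ] A)) := (compl (diagonalIdeal A)).ι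

/-- The first projection `π : T ⟶ S`. -/
noncomputable def projT : T A ⟶ Spec (.of A) :=
  inclT A ≫ Spec.map (CommRingCat.ofHom Algebra.TensorProduct.includeLeftRingHom)

variable {A}

/-- The ideal of a closed point `p` of `S`. -/
abbrev pointIdeal (p : ComplexPoints A) : Ideal A :=
  RingHom.ker (show A →ₐ[ℂ] ℂ from p)

/-- The closed immersion `j : {p} = Spec ℂ ⟶ S`. -/
noncomputable def pointHom (p : ComplexPoints A) : Spec (.of ℂ) ⟶ Spec (.of A) :=
  Spec.map (CommRingCat.ofHom (show A →ₐ[ℂ] ℂ from p).toRingHom)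

/-- The scheme `S ∖ {p}`. -/
noncomputable abbrev Punctured (p : ComplexPoints A) : Scheme.{0} := (compl (pointIdeal p)).toScheme

/-- The open immersion `S ∖ {p} ⟶ S`. -/
noncomputable abbrev inclPunctured (p : ComplexPoints A) : Punctured p ⟶ Spec (.of A) :=
  (compl (pointIdeal p)).ι

/-- The ring homomorphism `A ⊗ A ⟶ A`, `x ⊗ y ↦ x(p) y`. -/
noncomputable def sliceRingHom (p : ComplexPoints A) : A ⊗[ℂ] A →ₐ[ℂ] A :=
  Algebra.TensorProduct.lift ((Algebra.ofId ℂ A).comp (show A →ₐ[ℂ] ℂ from p)) (AlgHom.id ℂ A)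
    fun _ _ => Commute.all _ _

/-- The closed immersion `S ⟶ S × S`, `s ↦ (p, s)`. -/
noncomputable def slice (p : ComplexPoints A) : Spec (.of A) ⟶ Spec (.of (A ⊗[ℂ] A)) :=
  Spec.map (CommRingCat.ofHom (sliceRingHom p).toRingHom)

/-- The scheme `W`, with the morphism `w : W ⟶ S`, is the fibre of `π ∘ ρ : V ⟶ T ⟶ S` over the
closed point `p`: `w` factors through `ρ_p : W ⟶ S ∖ {p}`, the slice `s ↦ (p, s)` restricts to a
morphism `S ∖ {p} ⟶ T`, and there is a commutative diagram with cartesian squares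
```
    W     ⟶  V
    |         |
 S ∖ {p}  ⟶  T
    |         |
   {p}    ⟶  S
```
-/
def IsFibreDiagram {V : Scheme.{0}} (ρ : V ⟶ T A) (p : ComplexPoints A)
    {W : Scheme.{0}} (w : W ⟶ Spec (.of A)) : Prop :=
  ∃ (ρp : W ⟶ Punctured p) (top : W ⟶ V) (mid : Punctured p ⟶ T A),
    ρp ≫ inclPunctured p = w ∧
    mid ≫ inclT A = inclPunctured p ≫ slice p ∧
    IsPullback top ρp ρ mid ∧
    IsPullback mid (inclPunctured p ≫ structureHom A) (projT A) (pointHom p)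

open MvPolynomial in
/-- The coordinate ring of the hypersurface `{f V - g U = 1} ⊆ S × 𝔸²`, where `U` and `V` are the
variables of index `0` and `1`. -/
abbrev HypersurfaceRing (f g : A) : Type :=
  MvPolynomial (Fin 2) A ⧸
    Ideal.span {(C f * X 1 - C g * X 0 - 1 : MvPolynomial (Fin 2) A)}

/-- The projection of `{f V - g U = 1} ⊆ S × 𝔸²` to `S`. -/
noncomputable def hypersurfaceHom (f g : A) : Spec (.of (HypersurfaceRing f g)) ⟶ Spec (.of A) :=
  Spec.map (CommRingCat.ofHom (algebraMap A (HypersurfaceRing f g)))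

end Family

end SerreTorsor

namespace SerreTorsor

/-! Put `s = a(1)`. The kernel of `Sym F ⟶ Sym I` is generated by `s`, so V is the affine chart
D₊(s) of P(F) (`ker_symMap`, `complH_eq`). Its ring represents linear maps φ on F with φ(s) = 1,
that is, splittings of O ⟶ F (`isSplitting_divMap`), a description stable under base change
(`IsSplitting.exists_isPushout`).

The main tool is the alternating form ω on F with b(u)v − b(v)u = ω(u,v)s (`pairing`), which needs
no trivialization of F. Over a point of Δ the map F ⟶ I_Δ ⟶ Ω ⊗ k is onto a space of dimension 2,
hence an isomorphism on F ⊗ k, so `s` vanishes there and no splitting exists: V lies over T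
(`apply_s_eq_zero`, `map_eq_top`). Where some r = b(u₀) in I is invertible, a splitting is
determined by its arbitrary value at u₀, so V is locally T × 𝔸¹ (`nonempty_algEquiv_mvPolynomial`).
This yields smoothness, the dimension 1 + 2 + 2, integrality and surjectivity onto T; and Δ contains
no fibre of the first projection.

For the fibres, I_Δ is a direct summand of A ⊗ A over the first factor, so the resolution restricts
to one of I_p on {p} × S (`Resolution.atPoint`). Resolutions of I_p are unique up to isomorphisms
preserving `s` (`exists_linearEquiv`): a lift Φ of the identity of I_p sends `s` to t s' with t(p) ≠
0, and subtracting a suitable ω(w,·)s' turns t into the constant t(p). The Koszul complex of two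
generators is one such resolution (`exists_koszul`), and its splittings form the hypersurface fV −
gU = 1. -/

/-- The algebra `B`, with the linear map `β : F ⟶ B`, is universal among the `R`-algebras with a
linear map from `F` that sends `s` to `1`. -/
structure IsSplitting {R F B : Type} [CommRing R] [AddCommGroup F] [Module R F] [CommRing B]
    [Algebra R B] (s : F) (β : F →ₗ[R] B) : Prop where
  map_eq_one : β s = 1
  exists_lift : ∀ (C : Type) [CommRing C] [Algebra R C] (φ : F →ₗ[R] C), φ s = 1 →
    ∃ g : B →ₐ[R] C, ∀ u, g (β u) = φ u
  hom_ext : ∀ (C : Type) [CommRing C] [Algebra R C] (g h : B →ₐ[R] C),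
    (∀ u, g (β u) = h (β u)) → g = h

/-! ### The chart D₊(s) of a projective bundle and its universal property -/

section Proj

open HomogeneousLocalization

variable (R : Type) [CommRing R] (M : Type) [AddCommGroup M] [Module R M]

noncomputable instance awayAlgebra (f : SymmetricAlgebra R M) :
    Algebra R (Away (symGrading R M) f) where
  algebraMap := (algebraMap (symGrading R M 0) (Away (symGrading R M) f)).comp
    (algebraMap R (symGrading R M 0))
  commutes' _ _ := mul_comm _ _
  smul_def' r x := by
    apply val_injective
    obtain ⟨x, rfl⟩ := mk_surjective x
    rw [val_smul, val_mul]
    change r • _ = algebraMap (symGrading R M 0) (Localization _) (algebraMap R _ r) * _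
    rw [Algebra.smul_def]
    rfl

theorem val_algebraMap_away (f : SymmetricAlgebra R M) (r : R) :
    (algebraMap R (Away (symGrading R M) f) r).val = algebraMap R (Localization.Away f) r :=
  rfl

variable {M}

/-- The map `u ↦ u / s` from `M` to the degree zero part of `(Sym M)_s`. -/
noncomputable def divMap (s : M) :
    M →ₗ[R] Away (symGrading R M) (SymmetricAlgebra.ι R M s) where
  toFun u := Away.mk _ (ι_mem_symGrading R M s) 1 (SymmetricAlgebra.ι R M u)
    (by simpa using ι_mem_symGrading R M u)
  map_add' u v := by
    apply val_injective
    simp [Away.val_mk, Localization.add_mk_self]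
  map_smul' r u := by
    apply val_injective
    simp [Away.val_mk, Localization.smul_mk]

theorem divMap_apply (s u : M) : divMap R s u = Away.mk _ (ι_mem_symGrading R M s) 1
    (SymmetricAlgebra.ι R M u) (by simpa using ι_mem_symGrading R M u) :=
  rfl

theorem algebraMap_mul_val_divMap (s u : M) :
    algebraMap _ (Localization.Away (SymmetricAlgebra.ι R M s)) (SymmetricAlgebra.ι R M s) *
      (divMap R s u).val = algebraMap _ _ (SymmetricAlgebra.ι R M u) := by
  rw [divMap_apply, Away.val_mk, Localization.mk_eq_mk']
  have h := IsLocalization.mk'_spec' (Localization.Away (SymmetricAlgebra.ι R M s))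
    (SymmetricAlgebra.ι R M u)
    (⟨SymmetricAlgebra.ι R M s ^ 1, 1, rfl⟩ : Submonoid.powers (SymmetricAlgebra.ι R M s))
  simp only [pow_one] at h
  convert h
  exact pow_one _

/-- An element of Symⁿ is a sum of products of n linear forms, so dividing by sⁿ gives a polynomial
in the fractions u/s. -/
theorem away_mk_mem_adjoin (s : M) (n : ℕ) (x : SymmetricAlgebra R M)
    (hx : x ∈ symGrading R M n) (hx' : x ∈ symGrading R M (n • 1)) :
    Away.mk (symGrading R M) (ι_mem_symGrading R M s) n x hx' ∈
      Algebra.adjoin R (Set.range (divMap R s)) := by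
  induction hx using Submodule.pow_induction_on_left' with
  | algebraMap r =>
    convert Subalgebra.algebraMap_mem _ r
    apply val_injective
    rw [Away.val_mk, val_algebraMap_away]
    rw [IsScalarTower.algebraMap_apply R (SymmetricAlgebra R M) (Localization.Away _),
      ← Localization.mk_one_eq_algebraMap]
    congr 1
    ext; simp
  | add x y i hx hy ihx ihy =>
    convert add_mem (ihx (by simpa [symGrading] using hx)) (ihy (by simpa [symGrading] using hy))
    apply val_injective
    rw [val_add, Away.val_mk, Away.val_mk, Away.val_mk, Localization.add_mk_self]
  | mem_mul m hm i x hx ih =>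
    obtain ⟨u, rfl⟩ := hm
    have hx₁ : x ∈ symGrading R M (i • 1) := by simpa [symGrading] using hx
    have hu : divMap R s u ∈ Algebra.adjoin R (Set.range (divMap R s)) :=
      Algebra.subset_adjoin (Set.mem_range_self u)
    have h : Away.mk (symGrading R M) (ι_mem_symGrading R M s) i.succ _ hx' =
        divMap R s u * Away.mk _ (ι_mem_symGrading R M s) i x hx₁ := by
      apply val_injective
      rw [val_mul, divMap_apply, Away.val_mk, Away.val_mk, Away.val_mk, Localization.mk_mul]
      congr 1
      ext; simp [pow_succ']
    rw [h]
    exact mul_mem hu (ih hx₁)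

theorem adjoin_range_divMap (s : M) : Algebra.adjoin R (Set.range (divMap R s)) = ⊤ := by
  rw [eq_top_iff]
  rintro x -
  obtain ⟨n, a, ha, rfl⟩ := Away.mk_surjective (symGrading R M) (ι_mem_symGrading R M s) x
  exact away_mk_mem_adjoin R s n a (by simpa using ha) _

/-- The extension of φ to Sym M sends `s` to the unit 1, hence passes to the localization; its
degree zero part is the required map. -/
theorem isSplitting_divMap (s : M) : IsSplitting s (divMap R s) where
  map_eq_one := by
    apply val_injective
    rw [divMap_apply, Away.val_mk, val_one]
    convert Localization.mk_self _
    simp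
  exists_lift C _ _ φ hφ := by
    let l : Localization.Away (SymmetricAlgebra.ι R M s) →+* C :=
      IsLocalization.Away.lift (SymmetricAlgebra.ι R M s)
        (g := (SymmetricAlgebra.lift φ : SymmetricAlgebra R M →ₐ[R] C).toRingHom)
        (by simp [SymmetricAlgebra.lift_ι_apply, hφ])
    have hl (x) : l (algebraMap _ _ x) = SymmetricAlgebra.lift φ x :=
      IsLocalization.Away.lift_eq _ _ _
    refine ⟨{ l.comp (algebraMap (Away (symGrading R M) _) _) with commutes' := fun r => ?_ },
      fun u => ?_⟩
    · change l (algebraMap R (Away (symGrading R M) _) r).val = _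
      rw [val_algebraMap_away, IsScalarTower.algebraMap_apply R (SymmetricAlgebra R M), hl,
        AlgHom.commutes]
    · change l (divMap R s u).val = _
      have h1 : l (algebraMap _ _ (SymmetricAlgebra.ι R M s)) = 1 := by
        rw [hl, SymmetricAlgebra.lift_ι_apply, hφ]
      rw [← SymmetricAlgebra.lift_ι_apply (f := φ), ← hl, ← algebraMap_mul_val_divMap R s u,
        map_mul, h1, one_mul]
  hom_ext C _ _ g h hgh := by
    apply AlgHom.ext_of_adjoin_eq_top (adjoin_range_divMap R s)
    rintro _ ⟨u, rfl⟩
    exact hgh u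

end Proj

/-! ### The complement of Proj (Sym I) as D₊(s) -/

namespace Resolution

variable {R : Type} [CommRing R] {I : Ideal R} (E : Resolution I)

/-- The section of `F` that spans the kernel of `F ⟶ I`. -/
def s : E.F := E.a 1

theorem a_apply (r : R) : E.a r = r • E.s := by
  rw [s, ← map_smul, smul_eq_mul, mul_one]

/-- For the inclusion `≤`: in Sym F/(s) the module F acts through F/Rs ≅ I, so the quotient map
factors through Sym I and kills the kernel. -/
theorem ker_symMap : RingHom.ker E.symMap = Ideal.span {SymmetricAlgebra.ι R E.F E.s} := by
  apply le_antisymm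
  · let q := Ideal.Quotient.mkₐ R (Ideal.span {SymmetricAlgebra.ι R E.F E.s})
    let f : E.F →ₗ[R] _ := q.toLinearMap ∘ₗ SymmetricAlgebra.ι R E.F
    have hf : LinearMap.ker E.b ≤ LinearMap.ker f := by
      intro u hu
      obtain ⟨r, rfl⟩ := (E.exact u).1 hu
      rw [LinearMap.mem_ker, a_apply, map_smul]
      have : f E.s = 0 := Ideal.Quotient.eq_zero_iff_mem.2 (Ideal.mem_span_singleton_self _)
      rw [this, smul_zero]
    let e := E.b.quotKerEquivOfSurjective E.b_surjective
    let f' : I →ₗ[R] _ := (LinearMap.ker E.b).liftQ f hf ∘ₗ e.symm.toLinearMap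
    have hf' (u : E.F) : f' (E.b u) = f u := by
      have : e.symm (E.b u) = Submodule.Quotient.mk u := by
        rw [LinearEquiv.symm_apply_eq]; rfl
      change (LinearMap.ker E.b).liftQ f hf (e.symm (E.b u)) = _
      rw [this]; rfl
    have key : (SymmetricAlgebra.lift f').comp E.symMap = q := by
      apply SymmetricAlgebra.algHom_ext
      ext u
      change SymmetricAlgebra.lift f' (E.symMap (SymmetricAlgebra.ι R E.F u)) = _
      rw [symMap, SymmetricAlgebra.lift_ι_apply]
      change SymmetricAlgebra.lift f' (SymmetricAlgebra.ι R I (E.b u)) = _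
      rw [SymmetricAlgebra.lift_ι_apply, hf']
      rfl
    intro x hx
    apply Ideal.Quotient.eq_zero_iff_mem.1
    change q x = 0
    rw [← key, AlgHom.comp_apply, (RingHom.mem_ker.1 hx : E.symMap x = 0), map_zero]
  · rw [Ideal.span_le, Set.singleton_subset_iff, SetLike.mem_coe, RingHom.mem_ker]
    change E.symMap _ = 0
    rw [symMap, SymmetricAlgebra.lift_ι_apply, LinearMap.comp_apply, s,
      (E.exact _).2 ⟨1, rfl⟩, map_zero]

theorem complH_eq : (E.complH : (Proj (symGrading R E.F)).Opens) =
    Proj.basicOpen (symGrading R E.F) (SymmetricAlgebra.ι R E.F E.s) := by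
  apply TopologicalSpace.Opens.ext
  change (ProjectiveSpectrum.zeroLocus (symGrading R E.F) (RingHom.ker E.symMap))ᶜ =
    (ProjectiveSpectrum.basicOpen (symGrading R E.F) _ : Set _)
  rw [ker_symMap, ProjectiveSpectrum.zeroLocus_span, ProjectiveSpectrum.basicOpen_eq_zeroLocus_compl]

end Resolution

theorem exists_iso_spec_of_eq_basicOpen (R : Type) [CommRing R] {M : Type} [AddCommGroup M]
    [Module R M] (s : M) (U : (Proj (symGrading R M)).Opens)
    (hU : U = Proj.basicOpen (symGrading R M) (SymmetricAlgebra.ι R M s)) :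
    ∃ e : U.toScheme ≅ Spec (.of (HomogeneousLocalization.Away (symGrading R M)
      (SymmetricAlgebra.ι R M s))),
      U.ι ≫ Proj.toSpecZero (symGrading R M) ≫
        Spec.map (CommRingCat.ofHom (algebraMap R (symGrading R M 0))) =
      e.hom ≫ Spec.map (CommRingCat.ofHom (algebraMap R _)) := by
  subst hU
  refine ⟨Proj.basicOpenIsoSpec _ _ (ι_mem_symGrading R M s) one_pos, ?_⟩
  have h := Proj.awayι_toSpecZero (symGrading R M) _ (ι_mem_symGrading R M s) one_pos
  rw [← Proj.basicOpenIsoSpec_inv_ι, Category.assoc, Iso.inv_comp_eq] at h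
  rw [reassoc_of% h, ← Spec.map_comp]
  rfl

namespace Resolution

variable {R : Type} [CommRing R] {I : Ideal R} (E : Resolution I)

/-- The scheme `P(F) ∖ H` is the spectrum of an algebra that is universal for splittings. -/
theorem exists_isSplitting : ∃ (B : Type) (_ : CommRing B) (_ : Algebra R B) (β : E.F →ₗ[R] B)
    (e : E.V ≅ Spec (.of B)), IsSplitting E.s β ∧
      E.toBase = e.hom ≫ Spec.map (CommRingCat.ofHom (algebraMap R B)) :=
  let ⟨e, he⟩ := exists_iso_spec_of_eq_basicOpen R E.s _ E.complH_eq
  ⟨_, _, _, divMap R E.s, e, isSplitting_divMap R E.s, he⟩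

end Resolution

/-! ### The alternating form of a resolution and the vanishing of `s` -/

namespace Resolution

variable {R : Type} [CommRing R] {I : Ideal R} (E : Resolution I)

@[simp]
theorem b_s : E.b E.s = 0 :=
  (E.exact _).2 ⟨1, rfl⟩

theorem exists_eq_smul_s {u : E.F} (hu : E.b u = 0) : ∃ r : R, u = r • E.s := by
  obtain ⟨r, rfl⟩ := (E.exact u).1 hu
  exact ⟨r, E.a_apply r⟩

theorem smul_s_injective : Function.Injective fun r : R => r • E.s := fun r t h =>
  E.a_injective (by simpa only [a_apply] using h)

theorem exists_pairing (u v : E.F) :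
    ∃ r : R, (E.b u : R) • v - (E.b v : R) • u = r • E.s := by
  apply E.exists_eq_smul_s
  ext
  simp [mul_comm]

/-- The scalar `r` with `b(u) v - b(v) u = r s`. -/
noncomputable def pairingAux (u v : E.F) : R :=
  (E.exists_pairing u v).choose

theorem pairingAux_smul_s (u v : E.F) :
    E.pairingAux u v • E.s = (E.b u : R) • v - (E.b v : R) • u :=
  (E.exists_pairing u v).choose_spec.symm

/-- The alternating form `ω` on `F` with `b(u) v - b(v) u = ω(u, v) s`. -/
noncomputable def pairing : E.F →ₗ[R] E.F →ₗ[R] R :=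
  LinearMap.mk₂ R E.pairingAux
    (fun u u' v => E.smul_s_injective <| by
      simp only [add_smul, pairingAux_smul_s, map_add, Submodule.coe_add, smul_add]; abel)
    (fun c u v => E.smul_s_injective <| by
      simp only [smul_assoc, pairingAux_smul_s, map_smul, Submodule.coe_smul]
      module)
    (fun u v v' => E.smul_s_injective <| by
      simp only [add_smul, pairingAux_smul_s, map_add, Submodule.coe_add, smul_add]; abel)
    (fun c u v => E.smul_s_injective <| by
      simp only [smul_assoc, pairingAux_smul_s, map_smul, Submodule.coe_smul]
      module)

theorem pairing_smul_s (u v : E.F) :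
    E.pairing u v • E.s = (E.b u : R) • v - (E.b v : R) • u :=
  E.pairingAux_smul_s u v

theorem pairing_s (u : E.F) : E.pairing u E.s = E.b u :=
  E.smul_s_injective <| by simp [pairing_smul_s]

theorem s_pairing (u : E.F) : E.pairing E.s u = -E.b u :=
  E.smul_s_injective <| by simp [pairing_smul_s]

theorem pairing_self (u : E.F) : E.pairing u u = 0 :=
  E.smul_s_injective <| by simp [pairing_smul_s]

theorem pairing_swap (u v : E.F) : E.pairing v u = -E.pairing u v :=
  E.smul_s_injective <| by simp [pairing_smul_s]

/-- Over a field `k` over which `I` becomes two-dimensional, the section `s` vanishes. -/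
theorem apply_s_eq_zero {k : Type} [Field k] [Algebra R k] {N : Type} [AddCommGroup N] [Module k N]
    [Module R N] [IsScalarTower R k N] (hN : Module.finrank k N = 2) (f : I →ₗ[R] N)
    (hf : Submodule.span k (Set.range f) = ⊤) (φ : E.F →ₗ[R] k) : φ E.s = 0 := by
  have : Module.Finite k N := Module.finite_of_finrank_eq_succ hN
  have hF : Module.finrank k (k ⊗[R] E.F) = 2 := by
    have h := congrFun (Module.rankAtStalk_eq_finrank_of_free (R := k) (M := k ⊗[R] E.F)) ⊥
    rw [Module.rankAtStalk_baseChange, E.rank_eq] at h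
    simpa using h.symm
  let g : k ⊗[R] E.F →ₗ[k] N := (f ∘ₗ E.b).liftBaseChange k
  have hg (u : E.F) : g (1 ⊗ₜ u) = f (E.b u) := by simp [g]
  have hsurj : Function.Surjective g := by
    rw [← LinearMap.range_eq_top, eq_top_iff, ← hf, Submodule.span_le]
    rintro _ ⟨x, rfl⟩
    obtain ⟨u, rfl⟩ := E.b_surjective x
    exact ⟨_, hg u⟩
  -- A surjection between spaces of dimension 2 is injective, and `g` kills 1 ⊗ s because b(s) = 0.
  have hinj : Function.Injective g :=
    (LinearMap.injective_iff_surjective_of_finrank_eq_finrank (hF.trans hN.symm)).2 hsurj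
  have hs : (1 : k) ⊗ₜ[R] E.s = 0 := hinj (by rw [hg, b_s, map_zero, map_zero])
  simpa using congrArg (φ.liftBaseChange k) hs

end Resolution

/-! ### Uniqueness of resolutions at a smooth point; the Koszul resolution -/

section Point

variable {A : Type} [CommRing A] {k : Type} [Field k] [Algebra A k] {I : Ideal A}
  {N : Type} [AddCommGroup N] [Module k N] [Module A N] [IsScalarTower A k N]

namespace Resolution

variable (E : Resolution I)

/-- If ω vanished at the point, applying functionals ψ to b(u)v − b(v)u = ω(u,v)s would make
ψ(v)b(u) and ψ(u)b(v) agree modulo I². The images of F in N would then be pairwise proportional,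
against dim N = 2. -/
theorem exists_algebraMap_pairing_ne_zero (hI : ∀ x, x ∈ I ↔ algebraMap A k x = 0) (hN : Module.finrank k N = 2) (f : I →ₗ[A] N)
    (hf : Submodule.span k (Set.range f) = ⊤) :
    ∃ u v : E.F, algebraMap A k (E.pairing u v) ≠ 0 := by
  by_contra! h
  have hIz (x : A) (hx : x ∈ I) : algebraMap A k x = 0 := (hI x).1 hx
  have hf0 (x : A) (y : I) (hx : x ∈ I) : f (x • y) = 0 := by
    rw [map_smul, ← algebraMap_smul k, hIz x hx, zero_smul]
  have hcomm (ψ : E.F →ₗ[A] A) (u v : E.F) :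
      algebraMap A k (ψ v) • f (E.b u) = algebraMap A k (ψ u) • f (E.b v) := by
    have hs : ψ E.s ∈ I := by
      rw [hI]
      exact E.apply_s_eq_zero hN f hf (Algebra.linearMap A k ∘ₗ ψ)
    have hω : E.pairing u v ∈ I := by
      rw [hI]; exact h u v
    -- Both factors on the right lie in I, so `f` kills the product.
    have h1 : ψ v • E.b u - ψ u • E.b v = E.pairing u v • ⟨ψ E.s, hs⟩ := by
      have h2 := congrArg ψ (E.pairing_smul_s u v)
      ext
      simpa [mul_comm] using h2.symm
    have h2 := congrArg f h1
    rw [hf0 _ _ hω, map_sub, map_smul, map_smul, sub_eq_zero] at h2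
    rwa [algebraMap_smul, algebraMap_smul]
  have hzero (u v : E.F) (hv : f (E.b v) ∉ Submodule.span k {f (E.b u)}) : f (E.b u) = 0 := by
    -- The section `σ` supplies coordinate functionals on F. If f(b v) is not a multiple of f(b u),
    -- all coordinates of u vanish at the point, hence so does f(b u).
    obtain ⟨σ, hσ⟩ := Module.projective_def.1 E.projective
    have hu (q : E.F) : algebraMap A k (σ u q) = 0 := by
      by_contra hq
      apply hv
      rw [← inv_smul_smul₀ hq (f (E.b v))]
      have h1 : algebraMap A k (σ v q) • f (E.b u) = algebraMap A k (σ u q) • f (E.b v) :=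
        hcomm (Finsupp.lapply q ∘ₗ σ) u v
      rw [← h1]
      exact Submodule.smul_mem _ _ (Submodule.smul_mem _ _ (Submodule.mem_span_singleton_self _))
    conv_lhs => rw [← hσ u, Finsupp.linearCombination_apply, Finsupp.sum, map_sum, map_sum]
    refine Finset.sum_eq_zero fun q _ => ?_
    rw [map_smul, map_smul, ← algebraMap_smul k, hu, zero_smul]
  have : Module.Finite k N := Module.finite_of_finrank_eq_succ hN
  obtain ⟨u, hu⟩ : ∃ u, f (E.b u) ≠ 0 := by
    by_contra! h0
    have : Submodule.span k (Set.range f) ≤ ⊥ := by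
      rw [Submodule.span_le]
      rintro _ ⟨x, rfl⟩
      obtain ⟨u, rfl⟩ := E.b_surjective x
      exact h0 u
    rw [hf, top_le_iff] at this
    have h1 := finrank_top k N
    rw [← this, finrank_bot, hN] at h1
    exact absurd h1 (by norm_num)
  obtain ⟨v, hv⟩ : ∃ v, f (E.b v) ∉ Submodule.span k {f (E.b u)} := by
    by_contra! h0
    have : Submodule.span k (Set.range f) ≤ Submodule.span k {f (E.b u)} := by
      rw [Submodule.span_le]
      rintro _ ⟨x, rfl⟩
      obtain ⟨v, rfl⟩ := E.b_surjective x
      exact h0 v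
    have h1 := Submodule.finrank_mono this
    rw [hf, finrank_top, hN, finrank_span_singleton hu] at h1
    exact absurd h1 (by norm_num)
  exact hu (hzero u v hv)

/-- Two resolutions of the ideal of a point with two-dimensional cotangent space are isomorphic
if the residue field lifts to the ring. -/
theorem exists_linearEquiv (E' : Resolution I) (hu : ∀ x : A, algebraMap A k x ≠ 0 → ∃ c : Aˣ, algebraMap A k x = algebraMap A k c)
    (hI : ∀ x, x ∈ I ↔ algebraMap A k x = 0) (hN : Module.finrank k N = 2) (f : I →ₗ[A] N)
    (hf : Submodule.span k (Set.range f) = ⊤) :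
    ∃ e : E.F ≃ₗ[A] E'.F, e E.s = E'.s := by
  have hIz (x : A) (hx : x ∈ I) : algebraMap A k x = 0 := (hI x).1 hx
  obtain ⟨Φ, hΦ⟩ := Module.projective_lifting_property E'.b E.b E'.b_surjective
  replace hΦ (u : E.F) : E'.b (Φ u) = E.b u := LinearMap.congr_fun hΦ u
  obtain ⟨t, ht⟩ := E'.exists_eq_smul_s (u := Φ E.s) (by rw [hΦ, b_s])
  have hpair (u v : E.F) : E'.pairing (Φ u) (Φ v) = E.pairing u v * t := E'.smul_s_injective <| by
    simp only
    rw [pairing_smul_s, hΦ, hΦ, ← map_smul, ← map_smul, ← map_sub, ← pairing_smul_s, map_smul, ht,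
      smul_smul]
  -- F' is spanned by Φ(F) and s'. Pairings with s' lie in I and those on Φ(F) are multiples of t,
  -- so t(p) = 0 would make the form of `E'` vanish at p.
  have ht0 : algebraMap A k t ≠ 0 := by
    intro ht0
    obtain ⟨u', v', h⟩ := E'.exists_algebraMap_pairing_ne_zero hI hN f hf
    have hdec (w' : E'.F) : ∃ (w : E.F) (z : A), w' = Φ w + z • E'.s := by
      obtain ⟨w, hw⟩ := E.b_surjective (E'.b w')
      obtain ⟨z, hz⟩ := E'.exists_eq_smul_s (u := w' - Φ w) (by rw [map_sub, hΦ, hw, sub_self])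
      exact ⟨w, z, by rw [← hz]; abel⟩
    obtain ⟨u, y, rfl⟩ := hdec u'
    obtain ⟨v, z, rfl⟩ := hdec v'
    apply h
    simp [hpair, ht0, pairing_s, s_pairing, hIz _ (E'.b _).2]
  obtain ⟨c, hc⟩ := hu t ht0
  have htc : t - c ∈ I := by rw [hI, map_sub, hc, sub_self]
  obtain ⟨w, hw⟩ := E.b_surjective ⟨t - c, htc⟩
  -- Since ω(w,s) = b(w) = t − c, this correction replaces t by the unit c without changing the map
  -- to I.
  let Ψ : E.F →ₗ[A] E'.F := Φ - (E.pairing w).smulRight E'.s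
  have hΨ (u : E.F) : E'.b (Ψ u) = E.b u := by simp [Ψ, hΦ]
  have hΨs : Ψ E.s = (c : A) • E'.s := by
    simp only [Ψ, LinearMap.sub_apply, ht, LinearMap.smulRight_apply, pairing_s, hw]
    rw [← sub_smul, sub_sub_cancel]
  have hinj : Function.Injective Ψ := by
    rw [injective_iff_map_eq_zero]
    intro u h
    obtain ⟨z, rfl⟩ := E.exists_eq_smul_s (u := u) (by rw [← hΨ, h, map_zero])
    rw [map_smul, hΨs, smul_smul, ← zero_smul A E'.s] at h
    have h1 : z * c = 0 := E'.smul_s_injective h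
    rw [c.isUnit.mul_left_eq_zero] at h1
    rw [h1, zero_smul]
  have hsurj : Function.Surjective Ψ := by
    intro w'
    obtain ⟨w, hw⟩ := E.b_surjective (E'.b w')
    obtain ⟨z, hz⟩ := E'.exists_eq_smul_s (u := w' - Ψ w) (by rw [map_sub, hΨ, hw, sub_self])
    refine ⟨w + (z * ↑c⁻¹ : A) • E.s, ?_⟩
    rw [map_add, map_smul, hΨs, smul_smul, Units.inv_mul_cancel_right, ← hz]
    abel
  refine ⟨LinearEquiv.ofBijective Ψ ⟨hinj, hsurj⟩ ≪≫ₗ LinearEquiv.smulOfUnit c⁻¹, ?_⟩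
  change (c⁻¹ : Aˣ) • Ψ E.s = E'.s
  rw [hΨs]
  change (c⁻¹ : Aˣ) • (c • E'.s) = E'.s
  rw [inv_smul_smul]

/-- The Koszul complex of two generators of the ideal of a point is exact. -/
theorem exists_koszul (E : Resolution I) (hI : ∀ x, x ∈ I ↔ algebraMap A k x = 0) (hN : Module.finrank k N = 2) (f : I →ₗ[A] N)
    (hf : Submodule.span k (Set.range f) = ⊤)
    (hu : ∀ x : A, algebraMap A k x ≠ 0 → ∃ c : Aˣ, algebraMap A k x = algebraMap A k c)
    (x y : A) (hxy : Ideal.span {x, y} = I) :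
    ∃ (E' : Resolution I) (e : (Fin 2 → A) ≃ₗ[A] E'.F), e ![-y, x] = E'.s := by
  have hIz (x : A) (hx : x ∈ I) : algebraMap A k x = 0 := (hI x).1 hx
  have hx : x ∈ I := hxy ▸ Ideal.subset_span (by simp)
  have hy : y ∈ I := hxy ▸ Ideal.subset_span (by simp)
  obtain ⟨u, hux⟩ := E.b_surjective ⟨x, hx⟩
  obtain ⟨v, hvy⟩ := E.b_surjective ⟨y, hy⟩
  have hdec (w : E.F) : ∃ α β z : A, w = α • u + β • v + z • E.s := by
    obtain ⟨α, β, h⟩ := Ideal.mem_span_pair.1 (hxy.ge (E.b w).2)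
    obtain ⟨z, hz⟩ := E.exists_eq_smul_s (u := w - α • u - β • v) (by
      ext
      simp only [map_sub, map_smul, hux, hvy, ← h, Submodule.coe_sub, Submodule.coe_smul,
        smul_eq_mul, Submodule.coe_zero]
      ring)
    exact ⟨α, β, z, by rw [← hz]; abel⟩
  -- By `hdec`, u, v and s span F, and pairings with s vanish at the point; so ω(u,v) cannot vanish
  -- there.
  have ht0 : algebraMap A k (E.pairing u v) ≠ 0 := by
    intro h0
    obtain ⟨w, w', h⟩ := E.exists_algebraMap_pairing_ne_zero hI hN f hf
    obtain ⟨α, β, z, rfl⟩ := hdec w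
    obtain ⟨α', β', z', rfl⟩ := hdec w'
    apply h
    simp [pairing_self, E.pairing_swap u v, h0, pairing_s, s_pairing, hIz _ (E.b _).2]
  obtain ⟨c, hc⟩ := hu _ ht0
  have hct : c - E.pairing u v ∈ I := by rw [hI, map_sub, hc, sub_self]
  obtain ⟨α, β, hαβ⟩ := Ideal.mem_span_pair.1 (hxy.ge hct)
  -- Shifting u and v by multiples of s keeps their images x and y but adds αx + βy to ω(u,v), which
  -- makes it the unit c.
  obtain ⟨u', hux', hus'⟩ : ∃ u', (E.b u' : A) = x ∧ u' = u - β • E.s :=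
    ⟨_, by simp [hux], rfl⟩
  obtain ⟨v', hvy', hvs'⟩ : ∃ v', (E.b v' : A) = y ∧ v' = v + α • E.s :=
    ⟨_, by simp [hvy], rfl⟩
  have huv : E.pairing u' v' = c := by
    rw [hus', hvs']
    simp only [map_sub, map_add, map_smul, LinearMap.sub_apply, LinearMap.smul_apply, pairing_s,
      s_pairing, hux, hvy, E.b_s, smul_eq_mul, Submodule.coe_zero]
    linear_combination hαβ
  have hkos : (x • v' - y • u') = (c : A) • E.s := by
    rw [← huv, pairing_smul_s, hux', hvy']
  have : Nontrivial A := (algebraMap A k).domain_nontrivial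
  let b : (Fin 2 → A) →ₗ[A] I :=
    (LinearMap.proj 0).smulRight ⟨x, hx⟩ + (LinearMap.proj 1).smulRight ⟨y, hy⟩
  have hb (w : Fin 2 → A) : (b w : A) = w 0 * x + w 1 * y := by simp [b]
  let E' : Resolution I :=
    { F := Fin 2 → A
      rank_eq := fun q => by simp [Module.rankAtStalk_eq_finrank_of_free]
      a := LinearMap.toSpanSingleton A _ ![-y, x]
      b := b
      a_injective := by
        rw [injective_iff_map_eq_zero]
        intro r hr
        have h0 : r * -y = 0 := congrFun hr 0
        have h1 : r * x = 0 := congrFun hr 1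
        have h2 : (r * c) • E.s = (0 : A) • E.s := by
          rw [mul_smul, ← hkos, smul_sub, smul_smul, smul_smul, h1, ← neg_neg (r * y), ← mul_neg,
            h0]
          simp
        have h3 : r * c = 0 := E.smul_s_injective h2
        rwa [c.isUnit.mul_left_eq_zero] at h3
      exact := by
        intro w
        constructor
        · intro hw
          have hw0 : w 0 * x + w 1 * y = 0 := by rw [← hb, hw]; rfl
          obtain ⟨z, hz⟩ := E.exists_eq_smul_s (u := w 0 • u' + w 1 • v') (by
            ext
            simpa [hux', hvy'] using hw0)
          -- Pairing the relation with u' and v' gives c·w₁ = zx and c·w₀ = −zy, so w = (z/c)(−y,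
          -- x).
          have h1 := congrArg (E.pairing u') hz
          have h2 := congrArg (fun m => E.pairing m v') hz
          simp only [map_add, map_smul, pairing_self, pairing_s, s_pairing, LinearMap.add_apply,
            LinearMap.smul_apply, huv, hux', hvy', smul_eq_mul, mul_zero, zero_add, add_zero]
            at h1 h2
          refine ⟨z * ↑c⁻¹, ?_⟩
          have hc' : (c : A) * ↑c⁻¹ = 1 := c.mul_inv
          ext i
          fin_cases i
          · change z * ↑c⁻¹ * -y = w 0
            linear_combination w 0 * hc' - (↑c⁻¹ : A) * h2
          · change z * ↑c⁻¹ * x = w 1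
            linear_combination w 1 * hc' - (↑c⁻¹ : A) * h1
        · rintro ⟨r, rfl⟩
          ext
          rw [hb]
          change r * -y * x + r * x * y = 0
          ring
      b_surjective := by
        rintro ⟨z, hz⟩
        obtain ⟨p, q, h⟩ := Ideal.mem_span_pair.1 (hxy.ge hz)
        exact ⟨![p, q], Subtype.ext (by simpa [hb] using h)⟩ }
  exact ⟨E', LinearEquiv.refl _ _, (one_smul A _).symm⟩

end Resolution

end Point
-- Base change of the splitting algebra
namespace IsSplitting

variable {R F B : Type} [CommRing R] [AddCommGroup F] [Module R F] [CommRing B] [Algebra R B]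
  {s : F} {β : F →ₗ[R] B}

/-- The formation of the universal algebra commutes with base change. -/
theorem exists_isPushout (h : IsSplitting s β) {A B' : Type} [CommRing A] [Algebra R A]
    [CommRing B'] [Algebra A B'] {β' : A ⊗[R] F →ₗ[A] B'}
    (h' : IsSplitting ((1 : A) ⊗ₜ[R] s) β') :
    ∃ g : B →+* B', IsPushout (CommRingCat.ofHom (algebraMap R B))
      (CommRingCat.ofHom (algebraMap R A)) (CommRingCat.ofHom g)
      (CommRingCat.ofHom (algebraMap A B')) := by
  algebraize [(algebraMap A B').comp (algebraMap R A)]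
  obtain ⟨g, hg⟩ := h.exists_lift B' (β'.restrictScalars R ∘ₗ TensorProduct.mk R A F 1)
    h'.map_eq_one
  have hg' (u : F) : g (β u) = β' (1 ⊗ₜ u) := hg u
  let e : A ⊗[R] B →ₐ[A] B' :=
    Algebra.TensorProduct.lift (Algebra.ofId A B') g fun _ _ => Commute.all _ _
  -- The inverse of `e` comes from the universal property over A, since β ⊗ A sends 1 ⊗ s to 1.
  obtain ⟨i, hi⟩ := h'.exists_lift (A ⊗[R] B) (β.baseChange A) (by
    rw [LinearMap.baseChange_tmul, h.map_eq_one]; rfl)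
  have hei : e.comp i = AlgHom.id A B' := h'.hom_ext _ _ _ fun u => by
    rw [AlgHom.comp_apply, hi, AlgHom.id_apply]
    induction u with
    | zero => simp
    | add x y hx hy => rw [map_add, map_add, hx, hy, map_add]
    | tmul a u =>
      rw [LinearMap.baseChange_tmul, Algebra.TensorProduct.lift_tmul, hg', Algebra.ofId_apply,
        ← Algebra.smul_def, ← map_smul, TensorProduct.smul_tmul', smul_eq_mul, mul_one]
  have hie : i.comp e = AlgHom.id A _ := by
    apply Algebra.TensorProduct.ext
    · ext
    · refine h.hom_ext _ _ _ fun u => ?_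
      change i (e (1 ⊗ₜ β u)) = 1 ⊗ₜ β u
      rw [Algebra.TensorProduct.lift_tmul, hg', map_one, one_mul, hi, LinearMap.baseChange_tmul]
  let E : A ⊗[R] B ≃ₐ[A] B' := AlgEquiv.ofAlgHom e i hei hie
  refine ⟨g.toRingHom, .flip ?_⟩
  refine (CommRingCat.isPushout_tensorProduct R A B).of_iso (Iso.refl _) (Iso.refl _) (Iso.refl _)
    E.toRingEquiv.toCommRingCatIso (by simp) (by simp) ?_ ?_
  · ext a
    exact E.commutes a
  · ext x
    change e (1 ⊗ₜ x) = g x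
    simp [e]

end IsSplitting

/-! ### Restriction of a resolution to a closed subscheme of the base -/

/-- If `L` maps `x u` into `Q` for all `x` in an ideal of the base ring, it maps the product of
this ideal with the module into `Q`. -/
theorem map_mem_of_mem_map_smul_top {A R M N : Type} [CommRing A] [CommRing R] [Algebra A R]
    [AddCommGroup M] [Module R M] [AddCommGroup N] (J : Ideal A) (Q : AddSubgroup N) (L : M →+ N)
    (h : ∀ x ∈ J, ∀ u : M, L (algebraMap A R x • u) ∈ Q) (u : M)
    (hu : u ∈ J.map (algebraMap A R) • (⊤ : Submodule R M)) : L u ∈ Q := by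
  have key (j : R) (hj : j ∈ J.map (algebraMap A R)) : ∀ u : M, L (j • u) ∈ Q := by
    induction hj using Submodule.span_induction with
    | mem _ hx => obtain ⟨x, hx, rfl⟩ := hx; exact h x hx
    | zero => simp
    | add x y _ _ ihx ihy => intro u; rw [add_smul, map_add]; exact add_mem (ihx u) (ihy u)
    | smul a x _ ih => intro u; rw [smul_eq_mul, mul_comm, mul_smul]; exact ih _
  induction hu using Submodule.smul_induction_on' with
  | smul j hj u _ => exact key j hj u
  | add x _ y _ ihx ihy => rw [map_add]; exact add_mem ihx ihy

section Slice

variable {A R : Type} [CommRing A] [CommRing R] [Algebra A R] (J : Ideal A) {I : Ideal R}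
  (π : R →ₗ[A] I) (hπ : ∀ x : I, π x = x)

-- The A-linear projection π maps JR into JI and fixes x. This is the vanishing of Tor₁ that keeps I
-- inside R after reduction modulo J.
include hπ in
theorem mem_map_mul_of_mem (x : R) (hx : x ∈ I) (hxJ : x ∈ J.map (algebraMap A R)) :
    x ∈ J.map (algebraMap A R) * I := by
  have h := map_mem_of_mem_map_smul_top (R := R) J (J.map (algebraMap A R) * I).toAddSubgroup
    ((Submodule.subtype I).toAddMonoidHom.comp π.toAddMonoidHom) (fun a ha r => by
      change (π (algebraMap A R a • r) : R) ∈ _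
      rw [algebraMap_smul, map_smul]
      change a • (π r : R) ∈ _
      rw [Algebra.smul_def]
      exact Ideal.mul_mem_mul (Ideal.mem_map_of_mem _ ha) (π r).2) x (by simpa using hxJ)
  simpa [hπ ⟨x, hx⟩] using h

-- As a direct summand of R, the ideal I is projective over A, so b has an A-linear section σ. Then
-- u ↦ u − σ(b u) retracts F onto Rs and maps JF into J·Rs.
include hπ in
theorem Resolution.mem_map_of_smul_s_mem [Module.Projective A R] (E : Resolution I) (r : R)
    (hr : r • E.s ∈ J.map (algebraMap A R) • (⊤ : Submodule R E.F)) :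
    r ∈ J.map (algebraMap A R) := by
  let _ : Module A E.F := Module.compHom E.F (algebraMap A R)
  have : IsScalarTower A R E.F := ⟨fun a r u => by
    rw [Algebra.smul_def, mul_smul]; rfl⟩
  have : Module.Projective A I := Module.Projective.of_split
    ((Submodule.subtype I).restrictScalars A) π (LinearMap.ext hπ)
  obtain ⟨σ, hσ⟩ := Module.projective_lifting_property (E.b.restrictScalars A) LinearMap.id
    E.b_surjective
  replace hσ (x : I) : E.b (σ x) = x := LinearMap.congr_fun hσ x
  obtain ⟨t, ht, h⟩ := map_mem_of_mem_map_smul_top J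
    ((J.map (algebraMap A R) • Submodule.span R {E.s}).toAddSubgroup)
    (LinearMap.id - σ ∘ₗ E.b.restrictScalars A : E.F →ₗ[A] E.F).toAddMonoidHom (fun a ha u => by
      obtain ⟨t, ht⟩ := E.exists_eq_smul_s (u := u - σ (E.b u)) (by rw [map_sub, hσ, sub_self])
      change algebraMap A R a • u - σ (E.b (algebraMap A R a • u)) ∈ _
      have : σ (E.b (algebraMap A R a • u)) = algebraMap A R a • σ (E.b u) := by
        rw [map_smul, algebraMap_smul, map_smul, algebraMap_smul]
      rw [this, ← smul_sub, ht]
      exact Submodule.smul_mem_smul (Ideal.mem_map_of_mem _ ha)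
        (Submodule.smul_mem _ _ (Submodule.mem_span_singleton_self _))) _ hr |>
      Submodule.mem_smul_span_singleton.1
  have h' : t • E.s = r • E.s := by
    simpa using h
  rwa [← E.smul_s_injective h']

end Slice

namespace Resolution

variable {R : Type} [CommRing R] {I : Ideal R} (E : Resolution I)

/-- The base change of a resolution along a surjection `R ⟶ A` over which it stays exact. -/
noncomputable def baseChange {A : Type} [CommRing A] [Algebra R A] {I' : Ideal A}
    (hA : Function.Surjective (algebraMap R A)) (hI : I.map (algebraMap R A) = I')
    (h₁ : ∀ x ∈ I, algebraMap R A x = 0 → x ∈ RingHom.ker (algebraMap R A) * I)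
    (h₂ : ∀ r : R, r • E.s ∈ RingHom.ker (algebraMap R A) • (⊤ : Submodule R E.F) →
      algebraMap R A r = 0) : Resolution I' :=
  have hmk (x : A ⊗[R] E.F) : ∃ u : E.F, x = 1 ⊗ₜ u := by
    induction x with
    | zero => exact ⟨0, by simp⟩
    | add x y hx hy =>
      obtain ⟨u, rfl⟩ := hx
      obtain ⟨v, rfl⟩ := hy
      exact ⟨u + v, by rw [TensorProduct.tmul_add]⟩
    | tmul a u =>
      obtain ⟨r, rfl⟩ := hA a
      exact ⟨r • u, by rw [TensorProduct.tmul_smul, TensorProduct.smul_tmul', Algebra.smul_def,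
        mul_one]⟩
  let f : A ⊗[R] E.F →ₗ[A] A :=
    ((Algebra.linearMap R A) ∘ₗ I.subtype ∘ₗ E.b).liftBaseChange A
  have hf (u : E.F) : f (1 ⊗ₜ u) = algebraMap R A (E.b u) := by simp [f]
  have hker (u : E.F) (hu : (1 : A) ⊗ₜ[R] u = 0) :
      u ∈ RingHom.ker (algebraMap R A) • (⊤ : Submodule R E.F) := by
    have he : Function.Surjective (Algebra.ofId R A) := hA
    let e := (Ideal.quotientKerAlgEquivOfSurjective he).symm.toLinearMap
    have h1 : e 1 = 1 := map_one (Ideal.quotientKerAlgEquivOfSurjective he).symm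
    have h := congrArg
      (TensorProduct.quotTensorEquivQuotSMul E.F _ ∘ e.rTensor E.F) hu
    simp only [Function.comp_apply, LinearMap.rTensor_tmul, h1, map_zero] at h
    rw [← map_one (Ideal.Quotient.mk _), TensorProduct.quotTensorEquivQuotSMul_mk_tmul,
      one_smul] at h
    exact (Submodule.Quotient.mk_eq_zero _).1 h
  have hmem (x) : f x ∈ I' := by
    obtain ⟨u, rfl⟩ := hmk x
    rw [hf, ← hI]
    exact Ideal.mem_map_of_mem _ (E.b u).2
  { F := A ⊗[R] E.F
    rank_eq := fun y => by rw [Module.rankAtStalk_baseChange, E.rank_eq]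
    a := LinearMap.toSpanSingleton A _ (1 ⊗ₜ E.s)
    b := f.codRestrict I' hmem
    a_injective := by
      rw [injective_iff_map_eq_zero]
      intro a ha
      obtain ⟨r, rfl⟩ := hA a
      apply h₂
      apply hker
      rw [TensorProduct.tmul_smul, TensorProduct.smul_tmul', Algebra.smul_def, mul_one]
      rw [LinearMap.toSpanSingleton_apply, TensorProduct.smul_tmul', smul_eq_mul, mul_one] at ha
      exact ha
    exact := by
      intro x
      constructor
      · intro hx
        obtain ⟨u, rfl⟩ := hmk x
        have h := h₁ _ (E.b u).2 (by rw [← hf]; exact congrArg Subtype.val hx)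
        -- Such a w has the image of u in I but dies after base change; u − w is then a multiple of
        -- s.
        have h' : ∃ w : E.F, (E.b w : R) = E.b u ∧ (1 : A) ⊗ₜ[R] w = 0 := by
          generalize (E.b u : R) = x at h
          induction h using Submodule.mul_induction_on' with
          | mem_mul_mem j hj y hy =>
            obtain ⟨w, hw⟩ := E.b_surjective ⟨y, hy⟩
            refine ⟨j • w, by simp [hw], ?_⟩
            rw [TensorProduct.tmul_smul, TensorProduct.smul_tmul', Algebra.smul_def, 
              RingHom.mem_ker.1 hj, zero_mul, TensorProduct.zero_tmul]
          | add x _ y _ hx hy =>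
            obtain ⟨w, hw, hw'⟩ := hx
            obtain ⟨v, hv, hv'⟩ := hy
            exact ⟨w + v, by simp [hw, hv], by rw [TensorProduct.tmul_add, hw', hv', add_zero]⟩
        obtain ⟨w, hw, hw'⟩ := h'
        obtain ⟨r, hr⟩ := E.exists_eq_smul_s (u := u - w) (by
          rw [map_sub, sub_eq_zero]; exact Subtype.ext hw.symm)
        refine ⟨algebraMap R A r, ?_⟩
        rw [eq_add_of_sub_eq hr, TensorProduct.tmul_add, hw', add_zero, TensorProduct.tmul_smul,
          LinearMap.toSpanSingleton_apply, algebraMap_smul]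
      · rintro ⟨a, rfl⟩
        ext
        change f (a • (1 : A) ⊗ₜ E.s) = 0
        rw [map_smul, hf, b_s]
        simp
    b_surjective := by
      rintro ⟨x, hx⟩
      obtain ⟨y, hy, rfl⟩ := (Ideal.mem_map_iff_of_surjective _ hA).1 (hI.ge hx)
      obtain ⟨u, hu⟩ := E.b_surjective ⟨y, hy⟩
      exact ⟨1 ⊗ₜ u, Subtype.ext (by change f _ = _; rw [hf, hu])⟩ }

theorem baseChange_s {A : Type} [CommRing A] [Algebra R A] {I' : Ideal A}
    (hA : Function.Surjective (algebraMap R A)) (hI : I.map (algebraMap R A) = I')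
    (h₁ : ∀ x ∈ I, algebraMap R A x = 0 → x ∈ RingHom.ker (algebraMap R A) * I)
    (h₂ : ∀ r : R, r • E.s ∈ RingHom.ker (algebraMap R A) • (⊤ : Submodule R E.F) →
      algebraMap R A r = 0) :
    (E.baseChange hA hI h₁ h₂).s = (1 : A) ⊗ₜ[R] E.s :=
  one_smul A _

end Resolution

/-! ### Integrality of products over an algebraically closed field -/

section Domain

variable {K : Type} [Field K] [IsAlgClosed K] {A B : Type} [CommRing A] [Algebra K A] [CommRing B]
  [Algebra K B]

/-- Nullstellensatz: a residue field of A[1/a] at a maximal ideal is finite over K, hence equal to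
K. -/
theorem exists_algHom_ne_zero [IsDomain A] [Algebra.FiniteType K A] {a : A} (ha : a ≠ 0) :
    ∃ χ : A →ₐ[K] K, χ a ≠ 0 := by
  have : IsDomain (Localization.Away a) :=
    IsLocalization.isDomain_localization (powers_le_nonZeroDivisors_of_noZeroDivisors ha)
  obtain ⟨m, hm⟩ := Ideal.exists_maximal (Localization.Away a)
  let := Ideal.Quotient.field m
  have := finite_of_finite_type_of_isJacobsonRing K (Localization.Away a ⧸ m)
  let e := AlgEquiv.ofBijective (Algebra.ofId K (Localization.Away a ⧸ m))
    IsAlgClosed.algebraMap_bijective_of_isIntegral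
  let q : A →ₐ[K] Localization.Away a ⧸ m :=
    (Ideal.Quotient.mkₐ K m).comp (IsScalarTower.toAlgHom K A (Localization.Away a))
  refine ⟨(e.symm : _ →ₐ[K] K).comp q, ?_⟩
  have h : IsUnit (q a) := (IsLocalization.Away.algebraMap_isUnit a).map (Ideal.Quotient.mkₐ K m)
  exact (h.map (e.symm : _ →ₐ[K] K)).ne_zero

/-- Expand x and y in a K-basis of B with coefficients in A. A K-point of A at which one nonzero
coefficient of each survives specializes xy = 0 to a product of nonzero elements of B. -/
theorem isDomain_tensorProduct [IsDomain A] [IsDomain B] [Algebra.FiniteType K A] :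
    IsDomain (A ⊗[K] B) := by
  let b := Module.Free.chooseBasis K B
  let b' := Algebra.TensorProduct.basis A b
  have : Nontrivial (A ⊗[K] B) := by
    refine ⟨b' b.index_nonempty.some, 0, b'.ne_zero _⟩
  have hev (χ : A →ₐ[K] K) (x : A ⊗[K] B) (i) :
      b.repr (Algebra.TensorProduct.lift ((Algebra.ofId K B).comp χ) (AlgHom.id K B)
        (fun _ _ => Commute.all _ _) x) i = χ (b'.repr x i) := by
    induction x with
    | zero => simp
    | add x y hx hy => simp [hx, hy]
    | tmul a v =>
      rw [Algebra.TensorProduct.lift_tmul, AlgHom.comp_apply, Algebra.ofId_apply, AlgHom.id_apply,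
        ← Algebra.smul_def, map_smul, Algebra.TensorProduct.basis_repr_tmul]
      simp
  have : NoZeroDivisors (A ⊗[K] B) := ⟨by
    intro x y hxy
    by_contra! h
    obtain ⟨i, hi⟩ : ∃ i, b'.repr x i ≠ 0 := by
      by_contra! h0
      exact h.1 (b'.repr.map_eq_zero_iff.1 (Finsupp.ext h0))
    obtain ⟨j, hj⟩ : ∃ j, b'.repr y j ≠ 0 := by
      by_contra! h0
      exact h.2 (b'.repr.map_eq_zero_iff.1 (Finsupp.ext h0))
    obtain ⟨χ, hχ⟩ := exists_algHom_ne_zero (K := K) (mul_ne_zero hi hj)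
    rw [map_mul, ← hev, ← hev] at hχ
    have h1 := congrArg (Algebra.TensorProduct.lift ((Algebra.ofId K B).comp χ) (AlgHom.id K B)
        (fun _ _ => Commute.all _ _)) hxy
    rw [map_mul, map_zero, mul_eq_zero] at h1
    rcases h1 with h1 | h1 <;> simp [h1] at hχ⟩
  exact NoZeroDivisors.to_isDomain _

end Domain

/-! ### Cotangent spaces of the surface -/

section Kaehler

variable {A : Type} [CommRing A] [Algebra ℂ A]
  (hS : SmoothOfRelativeDimension 2 (structureHom A))

include hS

theorem locally_isStandardSmooth :
    RingHom.Locally (RingHom.IsStandardSmoothOfRelativeDimension 2) (algebraMap ℂ A) :=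
  HasRingHomProperty.Spec_iff.1 hS

theorem smooth_of_smoothOfRelativeDimension : Algebra.Smooth ℂ A := by
  rw [← RingHom.smooth_algebraMap]
  exact (HasRingHomProperty.Spec_iff (P := @Smooth)).1 (hS.smooth)

/-- The point factors through a standard smooth chart A[1/t], on which Ω is free of rank 2. -/
theorem finrank_tensorProduct_kaehler (k : Type) [Field k] [Algebra A k] :
    Module.finrank k (k ⊗[A] Ω[A⁄ℂ]) = 2 := by
  obtain ⟨s, hs, h⟩ := locally_isStandardSmooth hS
  obtain ⟨t, hts, ht⟩ : ∃ t ∈ s, algebraMap A k t ≠ 0 := by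
    by_contra! h0
    have h1 : s ⊆ RingHom.ker (algebraMap A k) := h0
    rw [← Ideal.span_le, hs] at h1
    exact one_ne_zero ((map_one _).symm.trans (h1 Submodule.mem_top : algebraMap A k 1 = 0))
  have h2 := h t hts
  rw [← IsScalarTower.algebraMap_eq, RingHom.isStandardSmoothOfRelativeDimension_algebraMap] at h2
  let g : Localization.Away t →+* k := IsLocalization.Away.lift t ht.isUnit
  algebraize [g]
  have : IsScalarTower A (Localization.Away t) k := .of_algebraMap_eq fun x =>
    (IsLocalization.Away.lift_eq t ht.isUnit x).symm
  have : Nontrivial (Localization.Away t) := g.domain_nontrivial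
  have : Algebra.FormallyEtale A (Localization.Away t) := .of_isLocalization (.powers t)
  have e := TensorProduct.AlgebraTensorModule.cancelBaseChange A (Localization.Away t) k k Ω[A⁄ℂ]
  have e' := (KaehlerDifferential.tensorKaehlerEquivOfFormallyEtale ℂ A (Localization.Away t)).baseChange 
    (Localization.Away t) k
  have := Algebra.IsStandardSmoothOfRelativeDimension.isStandardSmooth 2 (R := ℂ) (S := Localization.Away t)
  rw [← e.finrank_eq, e'.finrank_eq, Module.finrank_baseChange, Module.finrank,
    Algebra.IsStandardSmoothOfRelativeDimension.rank_kaehlerDifferential 2]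
  simp

end Kaehler

section Differential

variable (A : Type) [CommRing A] [Algebra ℂ A]

theorem span_eq_top_of_forall_tmul_D (k : Type) [Field k] [Algebra A k]
    (s : Set (k ⊗[A] Ω[A⁄ℂ])) (hf : ∀ a : A, (1 : k) ⊗ₜ[A] KaehlerDifferential.D ℂ A a ∈ s) :
    Submodule.span k s = ⊤ := by
  let D := KaehlerDifferential.D ℂ A
  rw [eq_top_iff]
  rintro x -
  induction x with
  | zero => exact zero_mem _
  | add x y hx hy => exact add_mem hx hy
  | tmul c ω =>
    have hω : ω ∈ Submodule.span A (Set.range D) := by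
      rw [KaehlerDifferential.span_range_derivation]; trivial
    induction hω using Submodule.span_induction generalizing c with
    | mem _ hx =>
      obtain ⟨a, rfl⟩ := hx
      have h1 : c ⊗ₜ[A] D a = c • (1 : k) ⊗ₜ[A] D a := by
        rw [TensorProduct.smul_tmul', smul_eq_mul, mul_one]
      rw [h1]
      exact Submodule.smul_mem _ _ (Submodule.subset_span (hf a))
    | zero => simp
    | add x y _ _ hx hy => rw [TensorProduct.tmul_add]; exact add_mem (hx c) (hy c)
    | smul a x _ hx =>
      rw [← TensorProduct.smul_tmul]
      exact hx _

/-- The map `I_Δ ⟶ Ω ⊗ k` for a field over which `Δ` has a point. -/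
theorem exists_diagonalIdeal_linearMap (k : Type) [Field k] [Algebra A k] [Algebra (A ⊗[ℂ] A) k]
    (h : ∀ x : A ⊗[ℂ] A, algebraMap (A ⊗[ℂ] A) k x =
      algebraMap A k (Algebra.TensorProduct.lmul' (S := A) ℂ x)) :
    ∃ f : diagonalIdeal A →ₗ[A ⊗[ℂ] A] k ⊗[A] Ω[A⁄ℂ], Submodule.span k (Set.range f) = ⊤ := by
  let D := KaehlerDifferential.D ℂ A
  let f : diagonalIdeal A →ₗ[A ⊗[ℂ] A] k ⊗[A] Ω[A⁄ℂ] :=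
    { toFun x := 1 ⊗ₜ D.tensorProductTo (x : A ⊗[ℂ] A)
      map_add' x y := by simp [TensorProduct.tmul_add]
      map_smul' r x := by
        -- In the Leibniz rule the term with factor μ(x) disappears on the diagonal ideal, which
        -- makes the map linear.
        have hx : Algebra.TensorProduct.lmul' (S := A) ℂ (x : A ⊗[ℂ] A) = 0 := x.2
        rw [Submodule.coe_smul, smul_eq_mul, Derivation.tensorProductTo_mul, hx, zero_smul,
          add_zero]
        rw [RingHom.id_apply, ← algebraMap_smul k r, h, algebraMap_smul, TensorProduct.tmul_smul] }
  refine ⟨f, ?_⟩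
  have hf (a : A) : (1 : k) ⊗ₜ[A] D a ∈ Set.range f := by
    refine ⟨⟨1 ⊗ₜ a - a ⊗ₜ 1, KaehlerDifferential.one_smul_sub_smul_one_mem_ideal ℂ a⟩, ?_⟩
    change 1 ⊗ₜ D.tensorProductTo (_ - _) = _
    simp [Derivation.tensorProductTo_tmul]
  exact span_eq_top_of_forall_tmul_D A k _ hf

/-- The map `I_p ⟶ Ω ⊗ ℂ` for a point `p`. -/
theorem exists_pointIdeal_linearMap (p : ComplexPoints A) :
    letI := (show A →ₐ[ℂ] ℂ from p).toRingHom.toAlgebra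
    ∃ f : pointIdeal p →ₗ[A] ℂ ⊗[A] Ω[A⁄ℂ], Submodule.span ℂ (Set.range f) = ⊤ := by
  let := (show A →ₐ[ℂ] ℂ from p).toRingHom.toAlgebra
  let D := KaehlerDifferential.D ℂ A
  let f : pointIdeal p →ₗ[A] ℂ ⊗[A] Ω[A⁄ℂ] :=
    { toFun x := 1 ⊗ₜ D (x : A)
      map_add' x y := by simp [TensorProduct.tmul_add]
      map_smul' r x := by
        have hx : (x : A) • (1 : ℂ) = 0 := by
          rw [Algebra.smul_def, mul_one]; exact x.2
        rw [Submodule.coe_smul, smul_eq_mul, Derivation.leibniz, TensorProduct.tmul_add,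
          ← TensorProduct.smul_tmul (x : A), hx, TensorProduct.zero_tmul, add_zero,
          TensorProduct.tmul_smul]
        rfl }
  refine ⟨f, span_eq_top_of_forall_tmul_D A ℂ _ fun a => ?_⟩
  have ha : a - algebraMap ℂ A ((show A →ₐ[ℂ] ℂ from p) a) ∈ pointIdeal p := by
    rw [RingHom.mem_ker, map_sub, AlgHom.commutes]
    exact sub_self _
  refine ⟨⟨_, ha⟩, ?_⟩
  change 1 ⊗ₜ D (_ - _) = _
  rw [map_sub, D.map_algebraMap, sub_zero]

end Differential

/-! ### Local structure of V over the base: smoothness, integrality, points -/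

theorem isStandardSmoothOfRelativeDimension_mvPolynomial (R : Type) [CommRing R] [Nontrivial R]
    (n : ℕ) : Algebra.IsStandardSmoothOfRelativeDimension n R (MvPolynomial (Fin n) R) := by
  let b := KaehlerDifferential.mvPolynomialBasis R (Fin n)
  have hb : Set.range b ⊆ Set.range (KaehlerDifferential.D R (MvPolynomial (Fin n) R)) := by
    rintro _ ⟨i, rfl⟩
    exact ⟨MvPolynomial.X i, by simp [b]⟩
  have := Algebra.IsStandardSmooth.of_basis_kaehlerDifferential b hb
  rw [Algebra.IsStandardSmoothOfRelativeDimension.iff_of_isStandardSmooth,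
    rank_eq_card_basis b, Fintype.card_fin]

namespace Resolution

variable {R : Type} [CommRing R] {I : Ideal R} (E : Resolution I) {B : Type} [CommRing B]
  [Algebra R B] {β : E.F →ₗ[R] B} (hB : IsSplitting E.s β)

include hB

/-- Over the complement of the zero locus of `I`, the scheme `P(F) ∖ H` is locally isomorphic to a
line bundle. -/
theorem nonempty_algEquiv_mvPolynomial (r : R) (hr : r ∈ I) :
    Nonempty (Localization.Away (algebraMap R B r) ≃ₐ[R]
      MvPolynomial (Fin 1) (Localization.Away r)) := by
  let L := Localization.Away r
  let P := MvPolynomial (Fin 1) L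
  let BL := Localization.Away (algebraMap R B r)
  obtain ⟨u₀, hu₀⟩ := E.b_surjective ⟨r, hr⟩
  have hu₀' : (E.b u₀ : R) = r := congrArg Subtype.val hu₀
  let i : L := IsLocalization.Away.invSelf r
  have hi : algebraMap R L r * i = 1 := IsLocalization.Away.mul_invSelf r
  -- A splitting satisfies rφ(u) = b(u)φ(u₀) + ω(u₀,u), by applying it to the definition of ω.
  -- Dividing by r and taking the variable for φ(u₀) gives this formula.
  let φ : E.F →ₗ[R] P :=
    (I.subtype ∘ₗ E.b).smulRight (MvPolynomial.C i * MvPolynomial.X 0) +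
      (E.pairing u₀).smulRight (MvPolynomial.C i)
  have hφ (u : E.F) : φ u = (E.b u : R) • (MvPolynomial.C i * MvPolynomial.X 0) +
      E.pairing u₀ u • MvPolynomial.C i := rfl
  have hri : r • (MvPolynomial.C i : P) = 1 := by
    rw [Algebra.smul_def, IsScalarTower.algebraMap_apply R L P, MvPolynomial.algebraMap_eq,
      ← map_mul, hi, map_one]
  obtain ⟨f, hf⟩ := hB.exists_lift P φ (by
    rw [hφ, pairing_s, hu₀', hri, E.b_s]; simp)
  have hfu : f (β u₀) = MvPolynomial.X 0 := by
    rw [hf, hφ, pairing_self, hu₀', ← smul_mul_assoc, hri]; simp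
  let fwd : BL →ₐ[R] P := IsLocalization.liftAlgHom (M := .powers (algebraMap R B r)) (f := f) (by
    rintro ⟨_, n, rfl⟩
    simp only [map_pow, AlgHom.commutes]
    refine IsUnit.pow n (IsUnit.of_mul_eq_one (MvPolynomial.C i) ?_)
    rw [← Algebra.smul_def, hri])
  have hfwd (x : B) : fwd (algebraMap B BL x) = f x := by
    simp [fwd]
  have hunit : IsUnit (algebraMap R BL r) := by
    rw [IsScalarTower.algebraMap_apply R B BL]
    exact IsLocalization.Away.algebraMap_isUnit _
  let g : L →ₐ[R] BL := IsLocalization.liftAlgHom (M := .powers r) (f := Algebra.ofId R BL) (by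
    rintro ⟨_, n, rfl⟩
    simp only [map_pow]
    exact hunit.pow n)
  algebraize [g.toRingHom]
  have : IsScalarTower R L BL := .of_algebraMap_eq fun x => (g.commutes x).symm
  let bwd : P →ₐ[R] BL :=
    (MvPolynomial.aeval fun _ => algebraMap B BL (β u₀) : P →ₐ[L] BL).restrictScalars R
  have hbX : bwd (MvPolynomial.X 0) = algebraMap B BL (β u₀) := MvPolynomial.aeval_X _ _
  have hbC (x : L) : bwd (MvPolynomial.C x) = algebraMap L BL x := MvPolynomial.aeval_C _ _
  refine ⟨AlgEquiv.ofAlgHom fwd bwd ?_ ?_⟩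
  · let j : L →ₐ[R] P := IsScalarTower.toAlgHom R L P
    have h1 : (fwd.comp bwd).comp j = j :=
      (IsLocalization.algHom_subsingleton (.powers r)).elim _ _
    apply AlgHom.ext
    intro x
    induction x using MvPolynomial.induction_on with
    | C a => exact DFunLike.congr_fun h1 a
    | add p q hp hq => rw [map_add, hp, hq, map_add]
    | mul_X p k hp =>
      obtain rfl := Subsingleton.elim k 0
      rw [map_mul, hp, AlgHom.comp_apply, hbX, hfwd, hfu]
      rfl
  · have h1 : ((bwd.comp fwd).comp (IsScalarTower.toAlgHom R B BL)) =
        IsScalarTower.toAlgHom R B BL := by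
      refine hB.hom_ext _ _ _ fun u => ?_
      change bwd (fwd (algebraMap B BL (β u))) = algebraMap B BL (β u)
      rw [hfwd, hf, hφ, map_add, map_smul, map_smul, map_mul, hbX, hbC]
      have h2 := congrArg (algebraMap B BL ∘ β) (E.pairing_smul_s u₀ u)
      simp only [Function.comp_apply, map_smul, map_sub, hB.map_eq_one, hu₀'] at h2
      have h3 : algebraMap R BL r * algebraMap L BL i = 1 := by
        rw [IsScalarTower.algebraMap_apply R L BL, ← map_mul, hi, map_one]
      simp only [Algebra.smul_def, map_mul, ← IsScalarTower.algebraMap_apply, mul_one] at h2 ⊢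
      linear_combination (algebraMap L BL i) * h2 + algebraMap B BL (β u) * h3
    have h2 : ((bwd.comp fwd : BL →ₐ[R] BL) : BL →+* BL) = RingHom.id BL := by
      apply IsLocalization.ringHom_ext (.powers (algebraMap R B r))
      refine RingHom.ext fun x => ?_
      have h2 := AlgHom.congr_fun h1 x
      exact h2
    exact AlgHom.ext fun x => RingHom.congr_fun h2 x

/-- Otherwise β followed by a residue field of B at a maximal ideal containing IB would send s to 1
over a point of the zero locus of I. -/
theorem map_eq_top (h : ∀ (k : Type) [Field k] [Algebra R k], (∀ x ∈ I, algebraMap R k x = 0) →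
    ∀ φ : E.F →ₗ[R] k, φ E.s = 0) : I.map (algebraMap R B) = ⊤ := by
  by_contra hne
  obtain ⟨m, hm, hIm⟩ := Ideal.exists_le_maximal _ hne
  let := Ideal.Quotient.field m
  refine one_ne_zero (α := B ⧸ m) ?_
  rw [← h (B ⧸ m) (fun x hx => ?_) ((Ideal.Quotient.mkₐ R m).toLinearMap ∘ₗ β)]
  · simp [hB.map_eq_one]
  · exact Ideal.Quotient.eq_zero_iff_mem.2 (hIm (Ideal.mem_map_of_mem _ hx))

theorem locally_isStandardSmooth [IsDomain R] (hI : I.map (algebraMap R B) = ⊤) :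
    RingHom.Locally (RingHom.IsStandardSmoothOfRelativeDimension 1) (algebraMap R B) := by
  -- The element r = 0 is left out so that R[1/r] is a nonzero ring.
  refine ⟨algebraMap R B '' {r | r ∈ I ∧ r ≠ 0}, ?_, ?_⟩
  · rw [eq_top_iff, ← hI, Ideal.map, Ideal.span_le]
    rintro _ ⟨r, hr, rfl⟩
    by_cases h0 : r = 0
    · simp [h0]
    · exact Ideal.subset_span ⟨r, ⟨hr, h0⟩, rfl⟩
  · rintro _ ⟨r, ⟨hr, h0⟩, rfl⟩
    obtain ⟨e⟩ := E.nonempty_algEquiv_mvPolynomial hB r hr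
    rw [← IsScalarTower.algebraMap_eq, RingHom.isStandardSmoothOfRelativeDimension_algebraMap]
    have : IsDomain (Localization.Away r) :=
      IsLocalization.isDomain_localization (powers_le_nonZeroDivisors_of_noZeroDivisors h0)
    have := isStandardSmoothOfRelativeDimension_mvPolynomial (Localization.Away r) 1
    have : Algebra.IsStandardSmoothOfRelativeDimension 0 R (Localization.Away r) :=
      .localization_away r
    have := Algebra.IsStandardSmoothOfRelativeDimension.trans (n := 0) (m := 1) R
      (Localization.Away r) (MvPolynomial (Fin 1) (Localization.Away r))
    exact .of_algEquiv _ e.symm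

theorem smoothOfRelativeDimension [IsDomain R] (hI : I.map (algebraMap R B) = ⊤) :
    SmoothOfRelativeDimension 1 (Spec.map (CommRingCat.ofHom (algebraMap R B))) :=
  HasRingHomProperty.Spec_iff.2 (E.locally_isStandardSmooth hB hI)

/-- B is flat over R, so a nonzero r in I is regular on B and B embeds in B[1/r] ≅ R[1/r][X]. -/
theorem isDomain [IsDomain R] (hI : I.map (algebraMap R B) = ⊤) (hI' : I ≠ ⊥) : IsDomain B := by
  have := E.smoothOfRelativeDimension hB hI
  have hs := SmoothOfRelativeDimension.smooth 1 (Spec.map (CommRingCat.ofHom (algebraMap R B)))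
  have hflat := (HasRingHomProperty.Spec_iff.1 hs).flat
  have : Module.Flat R B := by simpa [RingHom.flat_algebraMap_iff] using hflat
  obtain ⟨r, hr, h0⟩ := Submodule.exists_mem_ne_zero_of_ne_bot hI'
  have hL : IsDomain (Localization.Away r) :=
      IsLocalization.isDomain_localization (powers_le_nonZeroDivisors_of_noZeroDivisors h0)
  obtain ⟨e⟩ := E.nonempty_algEquiv_mvPolynomial hB r hr
  have : IsDomain (Localization.Away (algebraMap R B r)) := e.toMulEquiv.isDomain _
  have hreg : algebraMap R B r ∈ nonZeroDivisors B := by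
    rw [mem_nonZeroDivisors_iff_right]
    intro x hx
    apply Module.Flat.isSMulRegular_of_nonZeroDivisors (M := B) (mem_nonZeroDivisors_of_ne_zero h0)
    simpa [Algebra.smul_def, mul_comm] using hx
  exact (IsLocalization.injective (Localization.Away (algebraMap R B r))
    (Submonoid.powers_le.2 hreg)).isDomain (algebraMap B _)

/-- With r = b(u₀) nonzero at q, the map ω(u₀,·)/r is a splitting over the residue field of q, hence
a point of Spec B above q. -/
theorem exists_comap_eq (q : PrimeSpectrum R) (hq : ¬ I ≤ q.asIdeal) :
    ∃ Q : PrimeSpectrum B, PrimeSpectrum.comap (algebraMap R B) Q = q := by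
  obtain ⟨r, hr, hrq⟩ := SetLike.not_le_iff_exists.1 hq
  let k := q.asIdeal.ResidueField
  have hrk : algebraMap R k r ≠ 0 := by rwa [Ne, Ideal.algebraMap_residueField_eq_zero]
  obtain ⟨u₀, hu₀⟩ := E.b_surjective ⟨r, hr⟩
  obtain ⟨g, -⟩ := hB.exists_lift k
    ((E.pairing u₀).smulRight (algebraMap R k r)⁻¹) (by
      rw [LinearMap.smulRight_apply, pairing_s, hu₀, Algebra.smul_def, mul_inv_cancel₀ hrk])
  refine ⟨⟨RingHom.ker g, RingHom.ker_isPrime _⟩, PrimeSpectrum.ext ?_⟩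
  ext x
  change g (algebraMap R B x) = 0 ↔ _
  rw [g.commutes, Ideal.algebraMap_residueField_eq_zero]

end Resolution

/-! ### The diagonal ideal and the first projection -/

section Diagonal

variable {A : Type} [CommRing A] [Algebra ℂ A]

theorem sub_lmul'_tmul_one_mem (x : A ⊗[ℂ] A) :
    x - Algebra.TensorProduct.lmul' (S := A) ℂ x ⊗ₜ 1 ∈ diagonalIdeal A := by
  change Algebra.TensorProduct.lmul' (S := A) ℂ _ = 0
  simp

theorem one_tmul_sub_tmul_one_mem (a : A) : (1 : A) ⊗ₜ[ℂ] a - a ⊗ₜ 1 ∈ diagonalIdeal A :=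
  KaehlerDifferential.one_smul_sub_smul_one_mem_ideal ℂ a

theorem apply_s_eq_zero_of_diagonalIdeal (hS : SmoothOfRelativeDimension 2 (structureHom A))
    (E : Resolution (diagonalIdeal A)) (k : Type) [Field k] [Algebra (A ⊗[ℂ] A) k]
    (hk : ∀ x ∈ diagonalIdeal A, algebraMap (A ⊗[ℂ] A) k x = 0) (φ : E.F →ₗ[A ⊗[ℂ] A] k) :
    φ E.s = 0 := by
  let : Algebra A k := ((algebraMap (A ⊗[ℂ] A) k).comp
    (Algebra.TensorProduct.includeLeftRingHom : A →+* A ⊗[ℂ] A)).toAlgebra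
  obtain ⟨f, hf⟩ := exists_diagonalIdeal_linearMap A k fun x => by
    have h := hk _ (sub_lmul'_tmul_one_mem x)
    rw [map_sub, sub_eq_zero] at h
    exact h
  exact E.apply_s_eq_zero (finrank_tensorProduct_kaehler hS k) f hf φ

theorem exists_D_ne_zero [Nontrivial A] (hS : SmoothOfRelativeDimension 2 (structureHom A)) :
    ∃ a : A, KaehlerDifferential.D ℂ A a ≠ 0 := by
  by_contra! h
  obtain ⟨m, hm⟩ := Ideal.exists_maximal A
  let := Ideal.Quotient.field m
  have h0 : Subsingleton Ω[A⁄ℂ] := by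
    rw [← Submodule.subsingleton_iff A]
    refine subsingleton_of_bot_eq_top ?_
    rw [← KaehlerDifferential.span_range_derivation ℂ A, eq_comm, Submodule.span_eq_bot]
    rintro _ ⟨a, rfl⟩
    exact h a
  have h1 := finrank_tensorProduct_kaehler hS (A ⧸ m)
  rw [Module.finrank_zero_of_subsingleton] at h1
  exact absurd h1 (by norm_num)

/-- The fibre of the first projection over P is the spectrum of the domain A ⊗ κ(P); the point q is
its generic point. -/
theorem exists_prime_not_diagonalIdeal_le [IsDomain A]
    (hS : SmoothOfRelativeDimension 2 (structureHom A)) (P : PrimeSpectrum A) :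
    ∃ q : PrimeSpectrum (A ⊗[ℂ] A), ¬ diagonalIdeal A ≤ q.asIdeal ∧
      PrimeSpectrum.comap (Algebra.TensorProduct.includeLeftRingHom : A →+* A ⊗[ℂ] A) q = P := by
  have := smooth_of_smoothOfRelativeDimension hS
  let κ := P.asIdeal.ResidueField
  have : IsDomain (A ⊗[ℂ] κ) := isDomain_tensorProduct
  let χ : A ⊗[ℂ] A →ₐ[ℂ] A ⊗[ℂ] κ := Algebra.TensorProduct.lift
    (Algebra.TensorProduct.includeRight.comp (IsScalarTower.toAlgHom ℂ A κ))
    Algebra.TensorProduct.includeLeft fun _ _ => Commute.all _ _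
  have hχ (a b : A) : χ (a ⊗ₜ b) = b ⊗ₜ algebraMap A κ a := by
    simp [χ]
  refine ⟨⟨RingHom.ker χ, RingHom.ker_isPrime _⟩, fun h => ?_, PrimeSpectrum.ext ?_⟩
  · obtain ⟨a, ha⟩ := exists_D_ne_zero hS
    apply ha
    have h1 : χ (1 ⊗ₜ a - a ⊗ₜ 1) = 0 := h (one_tmul_sub_tmul_one_mem a)
    rw [map_sub, hχ, hχ, map_one] at h1
    -- If q were on the diagonal, then 1 ⊗ a = a(P) ⊗ 1 in κ(P) ⊗ A. Applying id ⊗ d gives 1 ⊗ da =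
    -- 0, and da = 0 follows by faithful flatness over ℂ.
    have h2 := congrArg ((KaehlerDifferential.D ℂ A).toLinearMap.lTensor κ ∘
      TensorProduct.comm ℂ A κ) h1
    simp only [Function.comp_apply, map_sub, map_zero, TensorProduct.comm_tmul,
      LinearMap.lTensor_tmul] at h2
    change (1 : κ) ⊗ₜ[ℂ] KaehlerDifferential.D ℂ A a - 
      _ ⊗ₜ KaehlerDifferential.D ℂ A 1 = 0 at h2
    rw [Derivation.map_one_eq_zero, TensorProduct.tmul_zero, sub_zero,
      Module.FaithfullyFlat.one_tmul_eq_zero_iff] at h2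
    exact h2
  · ext a
    change χ (a ⊗ₜ 1) = 0 ↔ _
    rw [hχ, ← Ideal.algebraMap_residueField_eq_zero]
    refine ⟨fun h => ?_, fun h => by rw [h, TensorProduct.tmul_zero]⟩
    apply Algebra.TensorProduct.includeRight_injective (R := ℂ) (A := A) (B := κ)
      (FaithfulSMul.algebraMap_injective ℂ A)
    rw [map_zero]
    exact h

theorem diagonalIdeal_ne_bot [IsDomain A] (hS : SmoothOfRelativeDimension 2 (structureHom A)) :
    diagonalIdeal A ≠ ⊥ := by
  obtain ⟨q, hq, -⟩ := exists_prime_not_diagonalIdeal_le hS ⟨⊥, Ideal.isPrime_bot⟩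
  intro h
  exact hq (h.le.trans bot_le)

/-- The first projection `S × S ⟶ S`. -/
noncomputable abbrev fstHom (A : Type) [CommRing A] [Algebra ℂ A] :
    Spec (.of (A ⊗[ℂ] A)) ⟶ Spec (.of A) :=
  Spec.map (CommRingCat.ofHom Algebra.TensorProduct.includeLeftRingHom)

theorem smoothOfRelativeDimension_fstHom (hS : SmoothOfRelativeDimension 2 (structureHom A)) :
    SmoothOfRelativeDimension 2 (fstHom A) :=
  (smoothOfRelativeDimension_isStableUnderBaseChange 2).of_isPullback
    (isPullback_SpecMap_of_isPushout _ _ _ _ (CommRingCat.isPushout_tensorProduct ℂ A A)).flip hS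

theorem structureHom_tensorProduct :
    structureHom (A ⊗[ℂ] A) = fstHom A ≫ structureHom A := by
  rw [structureHom, structureHom, ← Spec.map_comp]
  rfl

theorem smoothOfRelativeDimension_structureHom_tensorProduct
    (hS : SmoothOfRelativeDimension 2 (structureHom A)) :
    SmoothOfRelativeDimension (2 + 2) (structureHom (A ⊗[ℂ] A)) := by
  have := smoothOfRelativeDimension_fstHom hS
  rw [structureHom_tensorProduct]
  infer_instance

end Diagonal

/-! ### The slice {p} × S and the fibre squares -/

section Geometry

theorem exists_lift_compl {R B : Type} [CommRing R] [CommRing B] [Algebra R B] (I : Ideal R)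
    (hI : I.map (algebraMap R B) = ⊤) {V : Scheme.{0}} (e : V ≅ Spec (.of B)) :
    ∃ ρ : V ⟶ (compl I).toScheme,
      ρ ≫ (compl I).ι = e.hom ≫ Spec.map (CommRingCat.ofHom (algebraMap R B)) := by
  have h : Set.range (Spec.map (CommRingCat.ofHom (algebraMap R B))) ⊆
      Set.range (compl I).ι := by
    rw [Scheme.Opens.range_ι]
    rintro _ ⟨Q, rfl⟩
    intro hQ
    have h1 : I.map (algebraMap R B) ≤ Q.asIdeal := Ideal.map_le_iff_le_comap.2 hQ
    rw [hI, top_le_iff] at h1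
    exact Q.isPrime.ne_top h1
  refine ⟨e.hom ≫ IsOpenImmersion.lift (compl I).ι _ h, ?_⟩
  rw [Category.assoc, IsOpenImmersion.lift_fac]

theorem exists_isPullback_of_preimage_eq {X Y : Scheme.{0}} (f : X ⟶ Y) (U : Y.Opens) (U' : X.Opens)
    (h : f ⁻¹ᵁ U = U') : ∃ g : U'.toScheme ⟶ U.toScheme, IsPullback g U'.ι U.ι f := by
  subst h
  exact ⟨_, isPullback_morphismRestrict f U⟩

variable {A : Type} [CommRing A] [Algebra ℂ A] (p : ComplexPoints A)

/-- The evaluation of regular functions at a point. -/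
abbrev evalHom : A →ₐ[ℂ] ℂ := p

@[simp]
theorem sliceRingHom_tmul (a b : A) :
    sliceRingHom p (a ⊗ₜ b) = algebraMap ℂ A ((evalHom p) a) * b :=
  rfl

theorem sub_algebraMap_mem (a : A) :
    a - algebraMap ℂ A ((evalHom p) a) ∈ pointIdeal p := by
  rw [RingHom.mem_ker, map_sub, AlgHom.commutes]
  exact sub_self _

theorem map_diagonalIdeal :
    (diagonalIdeal A).map (sliceRingHom p).toRingHom = pointIdeal p := by
  apply le_antisymm
  · rw [Ideal.map_le_iff_le_comap]
    intro x hx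
    have h (x : A ⊗[ℂ] A) : (evalHom p) (sliceRingHom p x) =
        (evalHom p) (Algebra.TensorProduct.lmul' (S := A) ℂ x) := by
      induction x with
      | zero => simp
      | add x y hx hy => simp only [map_add, hx, hy]
      | tmul a b =>
        rw [sliceRingHom_tmul, map_mul, AlgHom.commutes, Algebra.TensorProduct.lmul'_apply_tmul,
          map_mul]
        rfl
    change (evalHom p) (sliceRingHom p x) = 0
    rw [h, show Algebra.TensorProduct.lmul' (S := A) ℂ x = 0 from hx, map_zero]
  · intro a ha
    have h := Ideal.mem_map_of_mem (sliceRingHom p).toRingHom (one_tmul_sub_tmul_one_mem a)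
    have h1 : (sliceRingHom p).toRingHom (1 ⊗ₜ a - a ⊗ₜ 1) = a := by
      change sliceRingHom p _ = _
      have ha' : (evalHom p) a = 0 := ha
      rw [map_sub, sliceRingHom_tmul, sliceRingHom_tmul, ha']
      simp
    rwa [h1] at h

theorem ker_sliceRingHom : RingHom.ker (sliceRingHom p).toRingHom =
    (pointIdeal p).map (algebraMap A (A ⊗[ℂ] A)) := by
  apply le_antisymm
  · have h (x : A ⊗[ℂ] A) : x - 1 ⊗ₜ sliceRingHom p x ∈
        (pointIdeal p).map (algebraMap A (A ⊗[ℂ] A)) := by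
      induction x with
      | zero => simp
      | add x y hx hy =>
        rw [map_add, TensorProduct.tmul_add, add_sub_add_comm]
        exact add_mem hx hy
      | tmul a b =>
        have h1 := Ideal.mul_mem_right (1 ⊗ₜ b) _
          (Ideal.mem_map_of_mem (algebraMap A (A ⊗[ℂ] A)) (sub_algebraMap_mem p a))
        convert h1 using 1
        rw [Algebra.TensorProduct.algebraMap_apply, Algebra.TensorProduct.tmul_mul_tmul,
          mul_one, one_mul, Algebra.algebraMap_self_apply, TensorProduct.sub_tmul,
          sliceRingHom_tmul, ← Algebra.smul_def, Algebra.algebraMap_eq_smul_one,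
          TensorProduct.smul_tmul]
    intro x hx
    have h1 := h x
    rwa [show sliceRingHom p x = 0 from hx, TensorProduct.tmul_zero, sub_zero] at h1
  · rw [Ideal.map_le_iff_le_comap]
    intro a ha
    change sliceRingHom p (a ⊗ₜ 1) = 0
    have ha' : (evalHom p) a = 0 := ha
    rw [sliceRingHom_tmul, ha', map_zero, zero_mul]

theorem slice_preimage_compl : slice p ⁻¹ᵁ compl (diagonalIdeal A) = compl (pointIdeal p) := by
  apply TopologicalSpace.Opens.ext
  change (PrimeSpectrum.comap (sliceRingHom p).toRingHom ⁻¹'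
    PrimeSpectrum.zeroLocus (diagonalIdeal A))ᶜ = (PrimeSpectrum.zeroLocus (pointIdeal p))ᶜ
  rw [PrimeSpectrum.preimage_comap_zeroLocus, ← map_diagonalIdeal p, Ideal.map,
    PrimeSpectrum.zeroLocus_span]

/-- The composite {p} ⟶ S ⟶ Spec ℂ is the identity, so the square results from cancelling the
product square against a trivial one. -/
theorem isPullback_slice : IsPullback (slice p) (structureHom A) (fstHom A) (pointHom p) := by
  have h : IsPushout (CommRingCat.ofHom (Algebra.TensorProduct.includeLeftRingHom : A →+* A ⊗[ℂ] A))
      (CommRingCat.ofHom (evalHom p).toRingHom)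
      (CommRingCat.ofHom (sliceRingHom p).toRingHom)
      (CommRingCat.ofHom (algebraMap ℂ A)) := by
    refine .flip (.of_left (h₁₁ := CommRingCat.ofHom (algebraMap ℂ A))
      (v₁₁ := CommRingCat.ofHom (algebraMap ℂ A)) (h₂₁ := CommRingCat.ofHom
        (Algebra.TensorProduct.includeRight : A →ₐ[ℂ] A ⊗[ℂ] A).toRingHom) ?_ ?_
      (CommRingCat.isPushout_tensorProduct ℂ A A))
    · have h1 : CommRingCat.ofHom (algebraMap ℂ A) ≫
          CommRingCat.ofHom (evalHom p).toRingHom = 𝟙 _ := by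
        ext x
        exact (evalHom p).commutes x
      have h2 : CommRingCat.ofHom (Algebra.TensorProduct.includeRight :
          A →ₐ[ℂ] A ⊗[ℂ] A).toRingHom ≫ CommRingCat.ofHom (sliceRingHom p).toRingHom = 𝟙 _ := by
        ext x
        change sliceRingHom p (1 ⊗ₜ x) = x
        simp
      rw [h1, h2]
      exact .of_horiz_isIso ⟨by simp⟩
    · ext x
      exact ((sliceRingHom_tmul p x 1).trans (mul_one _)).symm
  exact isPullback_SpecMap_of_isPushout _ _ _ _ h

/-- T and S ∖ {p} are open, the latter being the preimage of the former under the slice; pasting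
squares reduces everything to one square over S × S. -/
theorem isFibreDiagram_of_isPullback {V W : Scheme.{0}} (ρ : V ⟶ T A) (w : W ⟶ Spec (.of A))
    (top : W ⟶ V) (h : IsPullback top w (ρ ≫ inclT A) (slice p)) : IsFibreDiagram ρ p w := by
  obtain ⟨mid, hmid⟩ := exists_isPullback_of_preimage_eq _ _ _ (slice_preimage_compl p)
  have hw : (top ≫ ρ) ≫ inclT A = w ≫ slice p := by rw [Category.assoc, h.w]
  refine ⟨hmid.lift (top ≫ ρ) w hw, top, mid, hmid.lift_snd _ _ _, hmid.w, ?_,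
    hmid.paste_vert (isPullback_slice p)⟩
  refine .flip (.of_right (h₁₂ := inclPunctured p) (h₂₂ := inclT A) (v₁₃ := slice p) ?_ 
    (hmid.lift_fst _ _ _) hmid.flip)
  rw [hmid.lift_snd]
  exact h.flip

end Geometry

theorem IsSplitting.of_linearEquiv {R F F' B : Type} [CommRing R] [AddCommGroup F] [Module R F]
    [AddCommGroup F'] [Module R F'] [CommRing B] [Algebra R B] {s : F} {β : F →ₗ[R] B}
    (h : IsSplitting s β) (e : F' ≃ₗ[R] F) {s' : F'} (he : e s' = s) :
    IsSplitting s' (β ∘ₗ e.toLinearMap) where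
  map_eq_one := by simp [he, h.map_eq_one]
  exists_lift C _ _ φ hφ := by
    obtain ⟨g, hg⟩ := h.exists_lift C (φ ∘ₗ e.symm.toLinearMap) (by simp [← he, hφ])
    exact ⟨g, fun u => by simp [hg]⟩
  hom_ext C _ _ g g' hg := h.hom_ext C g g' fun u => by simpa using hg (e.symm u)

/-! ### The hypersurface as a scheme of splittings -/

section Hypersurface

open MvPolynomial

variable {A : Type} [CommRing A] (f g : A)

/-- The universal linear map to the coordinate ring of the hypersurface. -/
noncomputable def hypersurfaceMap : (Fin 2 → A) →ₗ[A] HypersurfaceRing f g :=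
  Fintype.linearCombination A fun i => Ideal.Quotient.mk _ (X i)

theorem hypersurfaceMap_apply (u : Fin 2 → A) : hypersurfaceMap f g u =
    u 0 • (Ideal.Quotient.mk _ (X 0) : HypersurfaceRing f g) + u 1 • Ideal.Quotient.mk _ (X 1) := by
  simp [hypersurfaceMap, Fintype.linearCombination_apply]

/-- A linear map on A² with values U, V on the standard basis sends (−g, f) to fV − gU, so the
equation says exactly that this vector goes to 1. -/
theorem isSplitting_hypersurfaceMap : IsSplitting ![-g, f] (hypersurfaceMap f g) where
  map_eq_one := by
    let J := Ideal.span {(C f * X 1 - C g * X 0 - 1 : MvPolynomial (Fin 2) A)}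
    have h : Ideal.Quotient.mk J (C (-g) * X 0 + C f * X 1) = 1 := by
      rw [← map_one (Ideal.Quotient.mk J), Ideal.Quotient.eq]
      refine (congrArg (· ∈ J) ?_).mpr (Ideal.mem_span_singleton_self _)
      rw [C_neg]
      ring
    rw [map_add, ← smul_eq_C_mul, ← smul_eq_C_mul] at h
    rw [hypersurfaceMap_apply]
    exact h
  exists_lift D _ _ φ hφ := by
    have hφ' : φ ![-g, f] = f • φ (Pi.single 1 1) - g • φ (Pi.single 0 1) := by
      rw [← map_smul, ← map_smul, ← map_sub]
      congr 1
      ext i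
      fin_cases i <;> simp
    let l := Ideal.Quotient.liftₐ (Ideal.span {(C f * X 1 - C g * X 0 - 1 : MvPolynomial (Fin 2) A)})
      (aeval fun i => φ (Pi.single i 1)) (by
        rintro x hx
        obtain ⟨y, rfl⟩ := Ideal.mem_span_singleton.1 hx
        rw [map_mul]
        have : aeval (R := A) (fun i => φ (Pi.single i 1)) (C f * X 1 - C g * X 0 - 1) = 0 := by
          rw [map_sub, map_sub, map_mul, map_mul, aeval_C, aeval_C, aeval_X, aeval_X, map_one,
            ← Algebra.smul_def, ← Algebra.smul_def, ← hφ', hφ, sub_self]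
        rw [this, zero_mul])
    have hl (i) : l (Ideal.Quotient.mk _ (X i)) = φ (Pi.single i 1) := aeval_X _ _
    refine ⟨l, fun u => ?_⟩
    rw [hypersurfaceMap_apply, map_add, map_smul, map_smul, hl, hl, ← map_smul, ← map_smul,
      ← map_add]
    congr 1
    ext i
    fin_cases i <;> simp
  hom_ext D _ _ a b hab := by
    apply Ideal.Quotient.algHom_ext
    apply MvPolynomial.algHom_ext
    intro i
    have h := hab (Pi.single i 1)
    have hi : hypersurfaceMap f g (Pi.single i 1) = Ideal.Quotient.mk _ (X i) := by
      rw [hypersurfaceMap_apply]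
      fin_cases i <;> simp
    rw [hi] at h
    exact h

end Hypersurface

/-! ### Fibres over closed points -/

section Point

variable {A : Type} [CommRing A] [Algebra ℂ A] (p : ComplexPoints A)
  (E : Resolution (diagonalIdeal A))

/-- The projection of `A ⊗ A` to the ideal of the diagonal that is linear over the first factor. -/
noncomputable def projDiagonal (A : Type) [CommRing A] [Algebra ℂ A] :
    A ⊗[ℂ] A →ₗ[A] diagonalIdeal A where
  toFun x := ⟨_, sub_lmul'_tmul_one_mem x⟩
  map_add' x y := by
    ext
    simp only [map_add, TensorProduct.add_tmul, Submodule.coe_add]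
    abel
  map_smul' a x := by
    have h : Algebra.TensorProduct.lmul' (S := A) ℂ (a • x) =
        a * Algebra.TensorProduct.lmul' (S := A) ℂ x := by
      rw [Algebra.smul_def, map_mul, Algebra.TensorProduct.algebraMap_apply,
        Algebra.TensorProduct.lmul'_apply_tmul, mul_one, Algebra.algebraMap_self_apply]
    ext
    change a • x - _ = a • (x - _)
    rw [h, smul_sub, TensorProduct.smul_tmul', smul_eq_mul]

theorem projDiagonal_apply (x : diagonalIdeal A) : projDiagonal A x = x := by
  ext
  change (x : A ⊗[ℂ] A) - Algebra.TensorProduct.lmul' (S := A) ℂ (x : A ⊗[ℂ] A) ⊗ₜ[ℂ] (1 : A) = x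
  rw [show Algebra.TensorProduct.lmul' (S := A) ℂ (x : A ⊗[ℂ] A) = 0 from x.2]
  simp

/-- The restriction of a resolution of the ideal of the diagonal to the slice `{p} × S`. -/
noncomputable def Resolution.atPoint : Resolution (pointIdeal p) :=
  letI : Algebra (A ⊗[ℂ] A) A := (sliceRingHom p).toRingHom.toAlgebra
  E.baseChange (A := A) (fun a => ⟨(1 : A) ⊗ₜ[ℂ] a, (sliceRingHom_tmul p 1 a).trans (by simp)⟩)
    (map_diagonalIdeal p)
    (fun x hx hx0 => by
      have h := (ker_sliceRingHom p).le (show x ∈ RingHom.ker (sliceRingHom p).toRingHom from hx0)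
      have h1 := mem_map_mul_of_mem (pointIdeal p) (projDiagonal A) projDiagonal_apply x hx h
      rwa [← ker_sliceRingHom p] at h1)
    (fun r hr => by
      have h := (ker_sliceRingHom p).le
      have h1 := E.mem_map_of_smul_s_mem (pointIdeal p) (projDiagonal A) projDiagonal_apply r
        (Submodule.smul_mono_left h hr)
      rw [← ker_sliceRingHom p] at h1
      exact h1)

/-- This reduces the fibre diagram to algebra: it suffices to match the restricted resolution, with
its section, to the pair (F, s) whose splittings W represents. -/
theorem isFibreDiagram_of_isSplitting (ρ : E.V ⟶ T A) (hρ : ρ ≫ inclT A = E.toBase)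
    {F B : Type} [AddCommGroup F] [Module A F] [CommRing B] [Algebra A B] {s : F} {β : F →ₗ[A] B}
    (h : IsSplitting s β) (e : (E.atPoint p).F ≃ₗ[A] F) (he : e (E.atPoint p).s = s)
    {W : Scheme.{0}} (w : W ⟶ Spec (.of A)) (i : W ≅ Spec (.of B))
    (hw : w = i.hom ≫ Spec.map (CommRingCat.ofHom (algebraMap A B))) : IsFibreDiagram ρ p w := by
  let : Algebra (A ⊗[ℂ] A) A := (sliceRingHom p).toRingHom.toAlgebra
  obtain ⟨B₀, _, _, β₀, e₀, h₀, hE⟩ := E.exists_isSplitting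
  have h' := h.of_linearEquiv e he
  have hs : (E.atPoint p).s = (1 : A) ⊗ₜ[A ⊗[ℂ] A] E.s := E.baseChange_s _ _ _ _
  rw [hs] at h'
  obtain ⟨g, hg⟩ := h₀.exists_isPushout h'
  have hpb := isPullback_SpecMap_of_isPushout _ _ _ _ hg
  refine isFibreDiagram_of_isPullback p ρ w
    (i.hom ≫ Spec.map (CommRingCat.ofHom g) ≫ e₀.inv) ?_
  rw [hρ]
  exact hpb.of_iso i.symm e₀.symm (Iso.refl _) (Iso.refl _) (by simp) (by simp [hw])
    (by simp [hE]) (by simp; rfl)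

/-- The unit is the constant function with value x(p). -/
theorem exists_unit_evalHom_eq (x : A) (hx : evalHom p x ≠ 0) :
    ∃ c : Aˣ, evalHom p x = evalHom p c :=
  ⟨Units.map (algebraMap ℂ A).toMonoidHom (Units.mk0 _ hx), ((evalHom p).commutes _).symm⟩

variable (hS : SmoothOfRelativeDimension 2 (structureHom A))

include hS

theorem exists_linearEquiv_atPoint (E' : Resolution (pointIdeal p)) :
    ∃ e : (E.atPoint p).F ≃ₗ[A] E'.F, e (E.atPoint p).s = E'.s := by
  let := (evalHom p).toRingHom.toAlgebra
  obtain ⟨f, hf⟩ := exists_pointIdeal_linearMap A p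
  exact (E.atPoint p).exists_linearEquiv (k := ℂ) E' (exists_unit_evalHom_eq p) (fun x => Iff.rfl)
    (finrank_tensorProduct_kaehler hS ℂ) f hf

theorem exists_linearEquiv_koszul (f g : A) (hfg : Ideal.span {f, g} = pointIdeal p) :
    ∃ e : (E.atPoint p).F ≃ₗ[A] (Fin 2 → A), e (E.atPoint p).s = ![-g, f] := by
  let := (evalHom p).toRingHom.toAlgebra
  obtain ⟨l, hl⟩ := exists_pointIdeal_linearMap A p
  obtain ⟨E', e', he'⟩ := (E.atPoint p).exists_koszul (k := ℂ) (fun x => Iff.rfl)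
    (finrank_tensorProduct_kaehler hS ℂ) l hl (exists_unit_evalHom_eq p) f g hfg
  obtain ⟨e, he⟩ := exists_linearEquiv_atPoint p E hS E'
  exact ⟨e.trans e'.symm, by rw [LinearEquiv.trans_apply, he, ← he', e'.symm_apply_apply]⟩

end Point

end SerreTorsor

theorem mainTheorem9 (A : Type) [CommRing A] [IsDomain A] [Algebra ℂ A]
    (hS : SmoothOfRelativeDimension 2 (SerreTorsor.structureHom A))
    (hc : ContractibleSpace (SerreTorsor.ComplexPoints A))
    (E : SerreTorsor.Resolution (SerreTorsor.diagonalIdeal A)) :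
    ∃ ρ : E.V ⟶ SerreTorsor.T A, ρ ≫ SerreTorsor.inclT A = E.toBase ∧
      (IsAffine E.V ∧ IsIntegral E.V ∧
        SmoothOfRelativeDimension 5 (E.toBase ≫ SerreTorsor.structureHom (A ⊗[ℂ] A))) ∧
      (Smooth (ρ ≫ SerreTorsor.projT A) ∧ Surjective (ρ ≫ SerreTorsor.projT A)) ∧
      ∀ p : SerreTorsor.ComplexPoints A,
        Nonempty (SerreTorsor.Resolution (SerreTorsor.pointIdeal p)) ∧
        (∀ Ep : SerreTorsor.Resolution (SerreTorsor.pointIdeal p),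
          SerreTorsor.IsFibreDiagram ρ p Ep.toBase) ∧
        ∀ f g : A, Ideal.span {f, g} = SerreTorsor.pointIdeal p →
          SerreTorsor.IsFibreDiagram ρ p (SerreTorsor.hypersurfaceHom f g) := by
  open SerreTorsor in
  have := smooth_of_smoothOfRelativeDimension hS
  have : IsDomain (A ⊗[ℂ] A) := isDomain_tensorProduct
  obtain ⟨B, _, _, β, e, hβ, hE⟩ := E.exists_isSplitting
  have htop : (diagonalIdeal A).map (algebraMap (A ⊗[ℂ] A) B) = ⊤ :=
    E.map_eq_top hβ (apply_s_eq_zero_of_diagonalIdeal hS E)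
  obtain ⟨ρ, hρ⟩ := exists_lift_compl (diagonalIdeal A) htop e
  rw [← hE] at hρ
  have hB : IsDomain B := E.isDomain hβ htop (diagonalIdeal_ne_bot hS)
  have hbase : SmoothOfRelativeDimension 1 E.toBase := by
    have := E.smoothOfRelativeDimension hβ htop
    rw [hE]
    exact smoothOfRelativeDimension_comp 0 1 _ _
  have hproj : ρ ≫ projT A = E.toBase ≫ fstHom A := by
    rw [projT, ← Category.assoc, hρ]
  refine ⟨ρ, hρ, ⟨.of_isIso e.hom, ?_, ?_⟩, ⟨?_, ?_⟩, fun p => ⟨⟨E.atPoint p⟩, fun Ep => ?_,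
    fun f g hfg => ?_⟩⟩
  · have : IsIntegral (Spec (.of B)) := inferInstance
    have : Nonempty E.V := (inferInstance : Nonempty (Spec (.of B))).map e.inv
    exact isIntegral_of_isOpenImmersion e.hom
  · have := smoothOfRelativeDimension_structureHom_tensorProduct hS
    exact smoothOfRelativeDimension_comp 1 (2 + 2) _ _
  · have := SmoothOfRelativeDimension.smooth 1 E.toBase
    have := smoothOfRelativeDimension_fstHom hS
    have := SmoothOfRelativeDimension.smooth 2 (fstHom A)
    rw [hproj]
    infer_instance
  · rw [hproj]
    refine ⟨fun P => ?_⟩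
    obtain ⟨q, hq, hqP⟩ := exists_prime_not_diagonalIdeal_le hS P
    obtain ⟨Q, hQ⟩ := E.exists_comap_eq hβ q hq
    let Q' : Spec (.of B) := Q
    have h : e.inv ≫ E.toBase ≫ fstHom A =
        Spec.map (CommRingCat.ofHom (algebraMap (A ⊗[ℂ] A) B)) ≫ fstHom A := by simp [hE]
    refine ⟨e.inv Q', ?_⟩
    rw [← Scheme.Hom.comp_apply, h]
    change PrimeSpectrum.comap _ (PrimeSpectrum.comap (algebraMap (A ⊗[ℂ] A) B) Q) = P
    rw [hQ]
    exact hqP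
  · obtain ⟨Bp, _, _, βp, ep, hβp, hEp⟩ := Ep.exists_isSplitting
    obtain ⟨l, hl⟩ := exists_linearEquiv_atPoint p E hS Ep
    exact isFibreDiagram_of_isSplitting p E ρ hρ hβp l hl _ ep hEp
  · obtain ⟨l, hl⟩ := exists_linearEquiv_koszul p E hS f g hfg
    exact isFibreDiagram_of_isSplitting p E ρ hρ (isSplitting_hypersurfaceMap f g) l hl _
      (Iso.refl _) (by simp [hypersurfaceHom])
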